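/- Let $\{Z_i\}_{i\ge 1}$ be a stationary Markov chain on a general state space $\mathcal X$ with transition kernel $P$ and invariant probability distribution $\pi$, and suppose it has a non-zero absolute $L_2$-spectral gap: $\lambda := \sup\{\|Ph\|_\pi : h\in L_2(\pi),\ \|h\|_\pi = 1,\ \pi(h)=0\} < 1$. Each state $Z_i$ carries a sample $({\bf x}_i, y_i)\in\mathbb R^d\times\mathbb R$ (a measurable function of $Z_i$), and $y_i = \langle {\bf x}_i,\beta^*\rangle + \varepsilon_i$ for some $\beta^*\in\mathbb R^d$. Let $({\bf x},\varepsilon)$ have the law of $({\bf x}_i,\varepsilon_i)$ under $\pi$. Suppose that $\Sigma = \mathbb E_\pi({\bf x}{\bf x}^\top)$ is positive definite and put $\bar{\bf x} = \Sigma^{-1/2}{\bf x}$. Suppose that the covariates are bounded, say $\|\bar{\bf x}\|_2\le K$ $\pi$-almost surely (as $\Sigma$ is invertible, some such $K$ exists exactly when ${\bf x}$ is bounded), and that for some $0<\delta\le 1$ and $v_\delta>0$ the errors satisfy $\mathbb E(\varepsilon\mid {\bf x}) = 0$ and $\mathbb E(|\varepsilon|^{1+\delta}\mid{\bf x})\le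 v_\delta$ $\pi$-almost surely. For $\tau>0$ let $\ell_\tau(x) = x^2/2$ if $|x|\le\tau$ and $\ell_\tau(x) = \tau|x|-\tau^2/2$ if $|x|>\tau$, and let $L_\tau(\beta) = \frac1{n_{\mathrm{sub}}}\sum_{i=1}^{n_{\mathrm{sub}}}\ell_\tau(y_i-\langle{\bf x}_i,\beta\rangle)$. Then there is a constant $C_0>0$ which depends only on $K$, is a sub-Gaussian constant of $\bar{\bf x}$, i.e. $\mathbb P_\pi(|\langle {\bf u},\bar{\bf x}\rangle|\ge p)\le 2\exp(-p^2/C_0^2)$ for all unit vectors ${\bf u}\in\mathbb R^d$ and all $p\ge 0$, and for which the following holds. For all $n_{\mathrm{sub}}\ge 1$, $\tau>0$ and $t>0$, with probability at least $1-2e^{-t}$, $$\|\Sigma^{-1/2}\nabla L_\tau(\beta^*)\|_2 \le \frac{4\sqrt{\pi}\,C_0A_2(d+t)\tau}{n_{\mathrm{sub}}} + 4C_0\sqrt{\frac{A_1v_\delta\tau^{1-\delta}(d+t)}{n_{\mathrm{sub}}}} + v_\delta\tau^{-\delta},$$ where in the first term on the right $\pi = 3.14\ldots$, $A_1 = \frac{1+\lambda}{1-\lambda}$,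 and $A_2 = \frac13$ if $\lambda\le 0$, $A_2 = \frac{5}{1-\lambda}$ if $\lambda>0$. -/

import Mathlib

open MeasureTheory ProbabilityTheory

namespace HuberMarkov

noncomputable section

/-! ### Markov chains and the absolute spectral gap -/

/-- `Z 0, Z 1, …` is a Markov chain with transition kernel `P` on the probability space `(Ω, μ)`:
conditionally on `(Z 0, …, Z k)`, the law of `Z (k + 1)` is `P (Z k)`. -/
structure IsMarkovChain {S Ω : Type*} [MeasurableSpace S] [MeasurableSpace Ω]
    (P : Kernel S S) (μ : Measure Ω) (Z : ℕ → Ω → S) : Prop where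
  measurable : ∀ k, Measurable (Z k)
  markov : ∀ k : ℕ,
    μ.map (fun ω => ((fun i : Fin (k + 1) => Z i ω), Z (k + 1) ω)) =
      (μ.map (fun ω => fun i : Fin (k + 1) => Z i ω)).compProd
        (P.comap (fun h : Fin (k + 1) → S => h (Fin.last k)) (measurable_pi_apply _))

/-- A Markov chain with kernel `P` that is stationary with invariant distribution `π`. -/
structure IsStationaryMarkovChain {S Ω : Type*} [MeasurableSpace S] [MeasurableSpace Ω]
    (P : Kernel S S) (π : Measure S) (μ : Measure Ω) (Z : ℕ → Ω → S) : Prop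
    extends IsMarkovChain P μ Z where
  invariant : P.Invariant π
  initial : μ.map (Z 0) = π

/-- `λ(P) = sup {‖P h‖_π : ‖h‖_π = 1, π(h) = 0}`, where `(P h)(z) = ∫ h(w) P(z, dw)` and `‖·‖_π` is
the norm of `L²(π)`.  (All these norms are at most `1` when `π` is invariant; the supremum is `0`
if there is no such `h`.)  The absolute spectral gap of `P` is `1 - λ(P)`. -/
def specLambda {S : Type*} [MeasurableSpace S] (P : Kernel S S) (π : Measure S) : ℝ :=
  sSup {r : ℝ | ∃ h : S → ℝ, MemLp h 2 π ∧ eLpNorm h 2 π = 1 ∧ ∫ z, h z ∂π = 0 ∧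
    r = (eLpNorm (fun z => ∫ w, h w ∂(P z)) 2 π).toReal}

/-- `A₁ = (1 + λ) / (1 - λ)`. -/
def A1 (lam : ℝ) : ℝ := (1 + lam) / (1 - lam)

/-- `A₂ = 1/3` if `λ ≤ 0`, and `A₂ = 5 / (1 - λ)` if `λ > 0`. -/
def A2 (lam : ℝ) : ℝ := if lam ≤ 0 then 1 / 3 else 5 / (1 - lam)

/-! ### Huber loss -/

/-- The Huber loss `ℓ_τ`. -/
def huberLoss (τ x : ℝ) : ℝ := if |x| ≤ τ then x ^ 2 / 2 else τ * |x| - τ ^ 2 / 2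

/-- The empirical Huber loss `L_τ(β) = (1/n) ∑ ℓ_τ(y_i - ⟨x_i, β⟩)` of the sample
`(x_i, y_i)`, `i < n`. -/
def empiricalLoss {d : ℕ} (τ : ℝ) (n : ℕ) (xs : ℕ → EuclideanSpace ℝ (Fin d)) (ys : ℕ → ℝ)
    (β : EuclideanSpace ℝ (Fin d)) : ℝ :=
  (1 / (n : ℝ)) * ∑ i ∈ Finset.range n, huberLoss τ (ys i - inner ℝ (xs i) β)

/-! ### Second moment matrix and whitening -/

/-- `Σ = E_π (x xᵀ)`. -/
def secondMoment {S : Type*} [MeasurableSpace S] {d : ℕ} (π : Measure S)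
    (x : S → EuclideanSpace ℝ (Fin d)) : Matrix (Fin d) (Fin d) ℝ :=
  Matrix.of fun i j => ∫ z, x z i * x z j ∂π

open scoped MatrixOrder in
/-- `A^{-1/2}`: the positive semidefinite square root of `A⁻¹`. -/
def invSqrt {d : ℕ} (A : Matrix (Fin d) (Fin d) ℝ) : Matrix (Fin d) (Fin d) ℝ :=
  CFC.sqrt A⁻¹

/-- `A^{-1/2} v`. -/
def whiten {d : ℕ} (A : Matrix (Fin d) (Fin d) ℝ) (v : EuclideanSpace ℝ (Fin d)) :
    EuclideanSpace ℝ (Fin d) :=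
  Matrix.toEuclideanCLM (𝕜 := ℝ) (invSqrt A) v

end

end HuberMarkov

namespace HuberMarkov

/-! The gradient at `βstar` is, up to sign, the empirical mean of `huberScore τ ε • x`. After
whitening, its norm splits into the norm of the `π`-mean (bias) and a centred fluctuation.

Bias: since `ε` has conditional mean zero given `x`, only the truncation error `huberScore τ ε - ε`
contributes, and it is at most `τ ^ (-δ) * |ε| ^ (1 + δ)`. A whitened direction has second moment
one, so the bias is at most `vδ * τ ^ (-δ)`. The same conditioning bounds the second moment of each
directional score by `vδ * τ ^ (1 - δ)`.

Fluctuation: a `5 ^ d`-point set of unit vectors detects half of every norm, so a union bound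
reduces matters to scalar sums along the chain, controlled by `IsStationaryMarkovChain.bernstein`.
For these, the exponential moment is the `π`-integral of an iterate of `G ↦ P (w G)` with `w = exp
(θ f)`. Splitting each iterate into its mean and its centred part gives two coupled linear
inequalities. The spectral gap contracts the centred part, and a suitable combination of the two
quantities grows by a factor at most `exp (9 θ² V / (1 - λ))` per step (`integral_backward_le`).
Chernoff's bound and a choice of `θ` finish the scalar estimate.

Boundedness of the whitened covariate makes the score bounded and gives the sub-Gaussian tail; `24 *
max K 1` serves as the constant in both roles. -/

lemma bounded_mul {α : Type*} {f g : α → ℝ} (hfb : ∃ C, ∀ z, |f z| ≤ C) (hgb : ∃ C, ∀ z, |g z| ≤ C) :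
    ∃ C, ∀ z, |f z * g z| ≤ C := by
  obtain ⟨C, hC⟩ := hfb
  obtain ⟨D, hD⟩ := hgb
  refine ⟨C * D, fun z => ?_⟩
  rw [abs_mul]
  exact mul_le_mul (hC z) (hD z) (abs_nonneg _) ((abs_nonneg _).trans (hC z))

lemma bounded_sub_const {α : Type*} {f : α → ℝ} (hfb : ∃ C, ∀ z, |f z| ≤ C) (c : ℝ) :
    ∃ C, ∀ z, |f z - c| ≤ C := by
  obtain ⟨C, hC⟩ := hfb
  exact ⟨C + |c|, fun z => (abs_sub _ _).trans (by gcongr; exact hC z)⟩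

lemma integrable_of_bounded {α : Type*} [MeasurableSpace α] {ν : Measure α} [IsFiniteMeasure ν]
    {h : α → ℝ} (hm : Measurable h) (hb : ∃ C, ∀ z, |h z| ≤ C) : Integrable h ν := by
  obtain ⟨C, hC⟩ := hb
  exact Integrable.of_bound hm.aestronglyMeasurable C (Filter.Eventually.of_forall hC)

lemma integrable_sq_of_bounded {α : Type*} [MeasurableSpace α] {ν : Measure α} [IsFiniteMeasure ν]
    {h : α → ℝ} (hm : Measurable h) (hb : ∃ C, ∀ z, |h z| ≤ C) :
    Integrable (fun z => h z ^ 2) ν := by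
  obtain ⟨C, hC⟩ := hb
  refine integrable_of_bounded (hm.pow_const 2) ⟨C ^ 2, fun z => ?_⟩
  rw [abs_pow]
  exact pow_le_pow_left₀ (abs_nonneg _) (hC z) 2

/-! ### Exponential functionals of a stationary chain -/

section Chain

variable {S Ω : Type*} [MeasurableSpace S] [MeasurableSpace Ω]

lemma measurable_kernel_integral (P : Kernel S S) [IsMarkovKernel P] {h : S → ℝ}
    (hm : Measurable h) : Measurable fun z => ∫ w, h w ∂(P z) :=
  (hm.stronglyMeasurable.integral_kernel (κ := P)).measurable

lemma abs_kernel_integral_le (P : Kernel S S) [IsMarkovKernel P] {h : S → ℝ} {C : ℝ}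
    (hC : ∀ z, |h z| ≤ C) (z : S) : |∫ w, h w ∂(P z)| ≤ C := by
  have := norm_integral_le_of_norm_le_const (μ := P z) (f := h) (C := C)
    (Filter.Eventually.of_forall hC)
  simpa using this

lemma integral_kernel_of_invariant {P : Kernel S S} [IsMarkovKernel P] {π : Measure S}
    [IsProbabilityMeasure π] (hP : P.Invariant π) {h : S → ℝ} (hi : Integrable h π) :
    ∫ z, ∫ w, h w ∂(P z) ∂π = ∫ z, h z ∂π := by
  have e : (P ∘ₖ Kernel.const Unit π) () = π := by
    rw [Kernel.comp_apply, Kernel.const_apply, hP.def]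
  have := Kernel.integral_comp (η := P) (κ := Kernel.const Unit π) (a := ()) (f := h) (by rwa [e])
  rw [e, Kernel.const_apply] at this
  exact this.symm

/-- The functions `z ↦ E[∏_{i=1}^k w(Z_i) | Z_0 = z]`. -/
noncomputable def backward (P : Kernel S S) (w : S → ℝ) : ℕ → S → ℝ
  | 0 => fun _ => 1
  | k + 1 => fun z => ∫ v, w v * backward P w k v ∂(P z)

variable {P : Kernel S S} [IsMarkovKernel P] {w : S → ℝ}

lemma measurable_backward (hw : Measurable w) (k : ℕ) : Measurable (backward P w k) := by
  induction k with
  | zero => exact measurable_const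
  | succ k ih => exact measurable_kernel_integral P (hw.mul ih)

lemma bounded_backward (hb : ∃ C, ∀ z, |w z| ≤ C) (k : ℕ) :
    ∃ C, ∀ z, |backward P w k z| ≤ C := by
  induction k with
  | zero => exact ⟨1, fun z => by simp [backward]⟩
  | succ k ih =>
    obtain ⟨C, hC⟩ := bounded_mul hb ih
    exact ⟨C, abs_kernel_integral_le P hC⟩

variable {μ : Measure Ω} [IsProbabilityMeasure μ] {Z : ℕ → Ω → S}

lemma IsMarkovChain.integral_history_mul (hZ : IsMarkovChain P μ Z) (k : ℕ)
    {H : (Fin (k + 1) → S) → ℝ} (hH : Measurable H) (hHb : ∃ C, ∀ z, |H z| ≤ C)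
    {G : S → ℝ} (hG : Measurable G) (hGb : ∃ C, ∀ z, |G z| ≤ C) :
    ∫ ω, H (fun i => Z i ω) * G (Z (k + 1) ω) ∂μ =
      ∫ ω, H (fun i => Z i ω) * ∫ v, G v ∂(P (Z k ω)) ∂μ := by
  have hm : Measurable (fun ω => fun i : Fin (k + 1) => Z i ω) :=
    measurable_pi_lambda _ fun i => hZ.measurable i
  have hF : Measurable (fun p : (Fin (k + 1) → S) × S => H p.1 * G p.2) :=
    (hH.comp measurable_fst).mul (hG.comp measurable_snd)
  have hFb : ∃ C, ∀ p : (Fin (k + 1) → S) × S, |H p.1 * G p.2| ≤ C := by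
    exact bounded_mul (f := fun p : (Fin (k + 1) → S) × S => H p.1) (hHb.imp fun C hC p => hC p.1)
      (hGb.imp fun C hC p => hC p.2)
  have := Measure.isProbabilityMeasure_map (μ := μ) hm.aemeasurable
  calc ∫ ω, H (fun i => Z i ω) * G (Z (k + 1) ω) ∂μ
      = ∫ p, H p.1 * G p.2 ∂(μ.map (fun ω => ((fun i : Fin (k + 1) => Z i ω), Z (k + 1) ω))) := by
        rw [integral_map (hm.prodMk (hZ.measurable _)).aemeasurable hF.aestronglyMeasurable]
    _ = ∫ h, ∫ v, H h * G v ∂(P (h (Fin.last k)))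
          ∂(μ.map (fun ω => fun i : Fin (k + 1) => Z i ω)) := by
        rw [hZ.markov k, Measure.integral_compProd (integrable_of_bounded hF hFb)]
        rfl
    _ = ∫ ω, H (fun i => Z i ω) * ∫ v, G v ∂(P (Z k ω)) ∂μ := by
        simp_rw [integral_const_mul]
        rw [integral_map hm.aemeasurable]
        · simp
        · exact (hH.mul ((measurable_kernel_integral P hG).comp
            (measurable_pi_apply _))).aestronglyMeasurable

lemma bounded_prod {ι : Type*} {α : Type*} (s : Finset ι) {g : ι → α → ℝ}
    (h : ∀ i, ∃ C, ∀ z, |g i z| ≤ C) : ∃ C, ∀ z, |∏ i ∈ s, g i z| ≤ C := by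
  choose C hC using h
  refine ⟨∏ i ∈ s, C i, fun z => ?_⟩
  rw [Finset.abs_prod]
  exact Finset.prod_le_prod (fun _ _ => abs_nonneg _) fun i _ => hC i z

/-- Conditioning on the history up to time `j` integrates out `Z (j + 1)`, and the last factor of
the product is absorbed into `backward`. -/
lemma IsMarkovChain.integral_prod_step (hZ : IsMarkovChain P μ Z) (hw : Measurable w)
    (hb : ∃ C, ∀ z, |w z| ≤ C) (j k : ℕ) :
    ∫ ω, (∏ i ∈ Finset.range (j + 2), w (Z i ω)) * backward P w k (Z (j + 1) ω) ∂μ =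
      ∫ ω, (∏ i ∈ Finset.range (j + 1), w (Z i ω)) * backward P w (k + 1) (Z j ω) ∂μ := by
  have hGb : ∃ C, ∀ z, |w z * backward P w k z| ≤ C :=
    bounded_mul hb (bounded_backward hb k)
  have key := hZ.integral_history_mul j (H := fun h => ∏ i, w (h i))
    (G := fun v => w v * backward P w k v)
    (Finset.measurable_prod _ fun i _ => hw.comp (measurable_pi_apply i))
    (bounded_prod _ fun i => hb.imp fun C hC h => hC (h i))
    (hw.mul (measurable_backward hw k)) hGb
  have e : ∀ ω, ∏ i : Fin (j + 1), w (Z i ω) = ∏ i ∈ Finset.range (j + 1), w (Z i ω) :=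
    fun ω => Fin.prod_univ_eq_prod_range (fun i => w (Z i ω)) (j + 1)
  simp only [e] at key
  rw [show (∫ ω, (∏ i ∈ Finset.range (j + 1), w (Z i ω)) * backward P w (k + 1) (Z j ω) ∂μ) = _
    from key.symm]
  congr 1
  ext ω
  rw [Finset.prod_range_succ]
  ring

lemma IsMarkovChain.integral_prod_eq (hZ : IsMarkovChain P μ Z) (hw : Measurable w)
    (hb : ∃ C, ∀ z, |w z| ≤ C) (j k : ℕ) :
    ∫ ω, (∏ i ∈ Finset.range (j + 1), w (Z i ω)) * backward P w k (Z j ω) ∂μ =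
      ∫ ω, w (Z 0 ω) * backward P w (j + k) (Z 0 ω) ∂μ := by
  induction j generalizing k with
  | zero => simp
  | succ j ih => rw [hZ.integral_prod_step hw hb, ih]; congr! 4; omega

variable {π : Measure S} [IsProbabilityMeasure π]

/-- Repeated conditioning leaves only the factor at time `0`. Invariance of `π` then allows one
extra application of `P`, which absorbs that factor too. -/
lemma IsStationaryMarkovChain.integral_prod_eq (hZ : IsStationaryMarkovChain P π μ Z)
    (hw : Measurable w) (hb : ∃ C, ∀ z, |w z| ≤ C) {n : ℕ} (hn : 0 < n) :
    ∫ ω, ∏ i ∈ Finset.range n, w (Z i ω) ∂μ = ∫ z, backward P w n z ∂π := by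
  obtain ⟨j, rfl⟩ := Nat.exists_eq_succ_of_ne_zero hn.ne'
  have h := hZ.toIsMarkovChain.integral_prod_eq hw hb j 0
  have hm : Measurable (fun v => w v * backward P w j v) := hw.mul (measurable_backward hw j)
  have hGb : ∃ C, ∀ z, |w z * backward P w j z| ≤ C :=
    bounded_mul hb (bounded_backward hb j)
  simp only [backward, mul_one, add_zero] at h
  rw [Nat.succ_eq_add_one, h, ← integral_map (f := fun v => w v * backward P w j v)
    (hZ.measurable 0).aemeasurable hm.aestronglyMeasurable,
    hZ.initial, ← integral_kernel_of_invariant hZ.invariant (integrable_of_bounded hm hGb)]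
  rfl

/-- Lets bounds holding only `π`-almost everywhere be transferred to every `Z k`. -/
lemma IsStationaryMarkovChain.map_eq (hZ : IsStationaryMarkovChain P π μ Z) (k : ℕ) :
    μ.map (Z k) = π := by
  induction k with
  | zero => exact hZ.initial
  | succ k ih =>
    have hm : Measurable (fun ω => fun i : Fin (k + 1) => Z i ω) :=
      measurable_pi_lambda _ fun i => hZ.measurable i
    have := Measure.isProbabilityMeasure_map (μ := μ) hm.aemeasurable
    have hpk := Measure.isProbabilityMeasure_map (μ := μ) (hZ.measurable (k + 1)).aemeasurable
    have h1 : ∀ A, MeasurableSet A → (μ.map (Z (k + 1))).real A = π.real A := by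
      intro A hA
      have hI : Measurable (A.indicator (fun _ => (1 : ℝ))) := measurable_const.indicator hA
      have hIb : ∃ C, ∀ z, |A.indicator (fun _ => (1 : ℝ)) z| ≤ C :=
        ⟨1, fun z => by by_cases hz : z ∈ A <;> simp [hz]⟩
      have e := hZ.toIsMarkovChain.integral_history_mul k (H := fun _ => 1) measurable_const
        ⟨1, by simp⟩ hI hIb
      simp only [one_mul] at e
      have e1 : ∫ z, A.indicator (fun _ => (1 : ℝ)) z ∂(μ.map (Z (k + 1)))
          = ∫ z, A.indicator (fun _ => (1 : ℝ)) z ∂π := by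
        rw [integral_map (hZ.measurable _).aemeasurable hI.aestronglyMeasurable, e,
          ← integral_map (f := fun z => ∫ v, A.indicator (fun _ => (1 : ℝ)) v ∂(P z))
            (hZ.measurable k).aemeasurable
            (measurable_kernel_integral P hI).aestronglyMeasurable, ih,
          integral_kernel_of_invariant hZ.invariant (integrable_of_bounded hI hIb)]
      rwa [integral_indicator hA, integral_indicator hA, setIntegral_one_eq_measureReal,
        setIntegral_one_eq_measureReal] at e1
    ext A hA
    have := h1 A hA
    rwa [Measure.real, Measure.real, ENNReal.toReal_eq_toReal_iff' (by simp) (by simp)] at this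

end Chain

/-! ### Contraction in `L²(π)` -/

section Gap

variable {S : Type*} [MeasurableSpace S] {P : Kernel S S} [IsMarkovKernel P] {π : Measure S}

/-- Jensen's inequality under each `P z`, then invariance. This makes the set defining `specLambda`
bounded above, without which its `sSup` would carry no information. -/
lemma eLpNorm_kernel_le (hP : P.Invariant π) {h : S → ℝ} (hh : AEStronglyMeasurable h π) :
    eLpNorm (fun z => ∫ w, h w ∂(P z)) 2 π ≤ eLpNorm h 2 π := by
  have e2 : ∀ (g : S → ℝ) (ν : Measure S),
      eLpNorm g 2 ν = (∫⁻ z, ‖g z‖ₑ ^ (2 : ℝ) ∂ν) ^ (1 / (2 : ℝ)) := by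
    intro g ν
    rw [eLpNorm_eq_lintegral_rpow_enorm_toReal (by simp) (by simp)]
    simp
  -- Invariance shows that a `π`-null set is `P z`-null for `π`-almost every `z`, so a measurable
  -- representative can be used.
  have hae : ∀ᵐ z ∂π, ∀ᵐ w ∂(P z), h w = hh.mk h w :=
    Measure.ae_ae_of_ae_comp (by rw [hP.def]; exact hh.ae_eq_mk)
  rw [e2, e2]
  refine ENNReal.rpow_le_rpow ?_ (by norm_num)
  have step : ∫⁻ z, ∫⁻ w, ‖hh.mk h w‖ₑ ^ (2 : ℝ) ∂(P z) ∂π = ∫⁻ z, ‖h z‖ₑ ^ (2 : ℝ) ∂π := by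
    rw [← Measure.lintegral_bind (f := fun w => ‖hh.mk h w‖ₑ ^ (2 : ℝ)) (Kernel.aemeasurable _)
      (by
        have := hh.stronglyMeasurable_mk.measurable
        fun_prop), hP.def]
    refine lintegral_congr_ae ?_
    filter_upwards [hh.ae_eq_mk] with z hz
    rw [hz]
  rw [← step]
  refine lintegral_mono_ae ?_
  filter_upwards [hae] with z hz
  rw [integral_congr_ae hz]
  have h12 := eLpNorm_le_eLpNorm_of_exponent_le (p := 1) (q := 2) (μ := P z) (f := hh.mk h)
    (by norm_num) hh.stronglyMeasurable_mk.aestronglyMeasurable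
  rw [eLpNorm_one_eq_lintegral_enorm, e2] at h12
  calc ‖∫ w, hh.mk h w ∂(P z)‖ₑ ^ (2 : ℝ)
      ≤ ((∫⁻ w, ‖hh.mk h w‖ₑ ^ (2 : ℝ) ∂(P z)) ^ (1 / (2 : ℝ))) ^ (2 : ℝ) :=
        ENNReal.rpow_le_rpow ((enorm_integral_le_lintegral_enorm _).trans h12) (by norm_num)
    _ = _ := by rw [← ENNReal.rpow_mul]; norm_num

lemma lpNorm_two_sq {h : S → ℝ} (hm : Measurable h) :
    lpNorm h 2 π ^ 2 = ∫ z, h z ^ 2 ∂π := by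
  have h0 : 0 ≤ ∫ z, h z ^ 2 ∂π := integral_nonneg fun z => sq_nonneg _
  rw [lpNorm_eq_integral_norm_rpow_toReal (by simp) (by simp) hm.aestronglyMeasurable]
  simp only [ENNReal.toReal_ofNat, Real.rpow_ofNat, Real.norm_eq_abs, sq_abs]
  rw [← Real.rpow_natCast, ← Real.rpow_mul h0]
  norm_num

lemma specLambda_nonneg (P : Kernel S S) (π : Measure S) : 0 ≤ specLambda P π := by
  refine Real.sSup_nonneg ?_
  rintro r ⟨h, -, -, -, rfl⟩
  exact ENNReal.toReal_nonneg

variable [IsProbabilityMeasure π]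

lemma memLp_two_of_bounded {h : S → ℝ} (hm : Measurable h) (hb : ∃ C, ∀ z, |h z| ≤ C) :
    MemLp h 2 π := by
  obtain ⟨C, hC⟩ := hb
  exact MemLp.of_bound hm.aestronglyMeasurable C (Filter.Eventually.of_forall hC)

lemma lpNorm_kernel_le (hP : P.Invariant π) {h : S → ℝ} (hm : Measurable h)
    (hb : ∃ C, ∀ z, |h z| ≤ C) (h0 : ∫ z, h z ∂π = 0) :
    lpNorm (fun z => ∫ w, h w ∂(P z)) 2 π ≤ specLambda P π * lpNorm h 2 π := by
  have hL : MemLp h 2 π := memLp_two_of_bounded hm hb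
  have hPm := measurable_kernel_integral P hm
  rw [← toReal_eLpNorm hPm.aestronglyMeasurable, ← toReal_eLpNorm hm.aestronglyMeasurable]
  rcases eq_or_ne (eLpNorm h 2 π) 0 with hz | hz
  · have := eLpNorm_kernel_le hP hm.aestronglyMeasurable
    rw [hz, nonpos_iff_eq_zero] at this
    rw [this, hz]
    simp
  have hfin : eLpNorm h 2 π ≠ ⊤ := hL.2.ne
  set N := (eLpNorm h 2 π).toReal with hN
  have hNpos : 0 < N := ENNReal.toReal_pos hz hfin
  have hgm : MemLp (N⁻¹ • h) 2 π := hL.const_smul _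
  have hg1 : eLpNorm (N⁻¹ • h) 2 π = 1 := by
    rw [eLpNorm_const_smul, ← ENNReal.ofReal_toReal hfin, ← hN, ← ofReal_norm,
      ← ENNReal.ofReal_mul (norm_nonneg _), Real.norm_of_nonneg (by positivity),
      inv_mul_cancel₀ hNpos.ne', ENNReal.ofReal_one]
  have hPg : eLpNorm (fun z => ∫ w, (N⁻¹ • h) w ∂(P z)) 2 π
      = ‖N⁻¹‖ₑ * eLpNorm (fun z => ∫ w, h w ∂(P z)) 2 π := by
    rw [← eLpNorm_const_smul]
    congr 1
    ext z
    simp [integral_const_mul]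
  have hle : (eLpNorm (fun z => ∫ w, (N⁻¹ • h) w ∂(P z)) 2 π).toReal ≤ specLambda P π := by
    refine le_csSup ⟨1, ?_⟩ ⟨N⁻¹ • h, hgm, hg1, ?_, rfl⟩
    · rintro r ⟨g, hg, hg1, -, rfl⟩
      have := eLpNorm_kernel_le hP hg.1
      rw [hg1] at this
      exact ENNReal.toReal_le_of_le_ofReal zero_le_one (by simpa using this)
    · simp [integral_const_mul, h0]
  rw [hPg, ENNReal.toReal_mul, toReal_enorm, Real.norm_of_nonneg (by positivity),
    inv_mul_le_iff₀ hNpos] at hle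
  linarith

lemma abs_integral_mul_le {f g : S → ℝ} (hf : Measurable f) (hg : Measurable g)
    (hfb : ∃ C, ∀ z, |f z| ≤ C) (hgb : ∃ C, ∀ z, |g z| ≤ C) :
    |∫ z, f z * g z ∂π| ≤ lpNorm f 2 π * lpNorm g 2 π := by
  have key := integral_mul_le_Lp_mul_Lq_of_nonneg (μ := π) (p := 2) (q := 2)
    (f := fun z => |f z|) (g := fun z => |g z|)
    (by constructor <;> norm_num) (Filter.Eventually.of_forall fun z => abs_nonneg _)
    (Filter.Eventually.of_forall fun z => abs_nonneg _)
    (by simpa using (memLp_two_of_bounded (π := π) hf hfb).norm)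
    (by simpa using (memLp_two_of_bounded (π := π) hg hgb).norm)
  rw [lpNorm_eq_integral_norm_rpow_toReal (by simp) (by simp) hf.aestronglyMeasurable,
    lpNorm_eq_integral_norm_rpow_toReal (by simp) (by simp) hg.aestronglyMeasurable]
  refine (abs_integral_le_integral_abs).trans ?_
  simp only [abs_mul]
  simpa using key

/-- The mean is the best constant approximation in `L²`. -/
lemma lpNorm_sub_integral_le {f : S → ℝ} (hf : Measurable f) (hfb : ∃ C, ∀ z, |f z| ≤ C)
    (c : ℝ) : lpNorm (fun z => f z - ∫ v, f v ∂π) 2 π ≤ lpNorm (fun z => f z - c) 2 π := by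
  rw [← sq_le_sq₀ lpNorm_nonneg lpNorm_nonneg, lpNorm_two_sq (hf.sub_const _),
    lpNorm_two_sq (hf.sub_const _)]
  have i1 : Integrable f π := integrable_of_bounded hf hfb
  have i2 : Integrable (fun z => f z ^ 2) π := integrable_sq_of_bounded hf hfb
  have e : ∀ a : ℝ, ∫ z, (f z - a) ^ 2 ∂π = ∫ z, f z ^ 2 ∂π - 2 * a * ∫ z, f z ∂π + a ^ 2 := by
    intro a
    have : ∀ z, (f z - a) ^ 2 = f z ^ 2 - 2 * a * f z + a ^ 2 := fun z => by ring
    simp_rw [this]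
    have i3 : Integrable (fun z => 2 * a * f z) π := i1.const_mul _
    rw [integral_add (f := fun z => f z ^ 2 - 2 * a * f z) (i2.sub i3) (integrable_const _),
      integral_sub i2 i3, integral_const_mul]
    simp
  rw [e, e]
  nlinarith [sq_nonneg (∫ z, f z ∂π - c)]

lemma lpNorm_mul_le {f g : S → ℝ} {A : ℝ} (hA : ∀ z, |f z| ≤ A) (hf : Measurable f)
    (hg : Measurable g) (hgb : ∃ C, ∀ z, |g z| ≤ C) :
    lpNorm (fun z => f z * g z) 2 π ≤ A * lpNorm g 2 π := by
  have hA0 : 0 ≤ A := by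
    obtain ⟨z⟩ := π.nonempty_of_neZero
    exact (abs_nonneg _).trans (hA z)
  rw [← sq_le_sq₀ lpNorm_nonneg (mul_nonneg hA0 lpNorm_nonneg), mul_pow,
    lpNorm_two_sq (h := fun z => f z * g z) (hf.mul hg), lpNorm_two_sq hg, ← integral_const_mul]
  have ig : Integrable (fun z => g z ^ 2) π := integrable_sq_of_bounded hg hgb
  refine integral_mono_of_nonneg (Filter.Eventually.of_forall fun z => sq_nonneg _)
    (ig.const_mul _) (Filter.Eventually.of_forall fun z => ?_)
  simp only [mul_pow]
  refine mul_le_mul_of_nonneg_right ?_ (sq_nonneg _)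
  rw [← sq_abs]
  exact pow_le_pow_left₀ (abs_nonneg _) (hA z) 2

end Gap

/-! ### Exponential moments and Bernstein's inequality -/

section Bernstein

variable {S Ω : Type*} [MeasurableSpace S] [MeasurableSpace Ω] {P : Kernel S S}
  {π : Measure S} [IsProbabilityMeasure π] {μ : Measure Ω} [IsProbabilityMeasure μ]
  {Z : ℕ → Ω → S}

lemma backward_nonneg {P : Kernel S S} {w : S → ℝ} (hw : ∀ z, 0 ≤ w z) (k : ℕ) (z : S) :
    0 ≤ backward P w k z := by
  induction k generalizing z with
  | zero => exact zero_le_one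
  | succ k ih => exact integral_nonneg fun v => mul_nonneg (hw v) (ih v)

variable [IsMarkovKernel P]

lemma integral_backward_succ (hP : P.Invariant π) {w : S → ℝ} (hw : Measurable w)
    (hb : ∃ C, ∀ z, |w z| ≤ C) (k : ℕ) :
    ∫ z, backward P w (k + 1) z ∂π = ∫ z, w z * backward P w k z ∂π :=
  integral_kernel_of_invariant hP (integrable_of_bounded (hw.mul (measurable_backward hw k))
    (bounded_mul hb (bounded_backward hb k)))

lemma integral_backward_succ_le (hP : P.Invariant π) {w : S → ℝ} (hw : Measurable w)
    (hb : ∃ C, ∀ z, |w z| ≤ C) (k : ℕ) :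
    ∫ z, backward P w (k + 1) z ∂π ≤
      (∫ z, backward P w k z ∂π) * ∫ z, w z ∂π + lpNorm (fun z => w z - 1) 2 π *
        lpNorm (fun z => backward P w k z - ∫ v, backward P w k v ∂π) 2 π := by
  have hG := measurable_backward (P := P) hw k
  have hGb := bounded_backward (P := P) hb k
  rw [integral_backward_succ hP hw hb]
  set G := backward P w k
  set a := ∫ z, G z ∂π with ha
  have iw : Integrable w π := integrable_of_bounded hw hb
  have iG : Integrable G π := integrable_of_bounded hG hGb
  have ip : Integrable (fun z => (w z - 1) * (G z - a)) π :=
    integrable_of_bounded ((hw.sub_const _).mul (hG.sub_const _))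
      (bounded_mul (bounded_sub_const hb 1) (bounded_sub_const hGb a))
  have i1 : Integrable (fun z => a * w z) π := iw.const_mul a
  have i2 : Integrable (fun z => G z - a) π := iG.sub (integrable_const _)
  have e : ∫ z, w z * G z ∂π = a * ∫ z, w z ∂π + ∫ z, (w z - 1) * (G z - a) ∂π := by
    -- The last term has mean zero; the middle one is a product of two small factors and goes to
    -- Cauchy–Schwarz.
    have : ∀ z, w z * G z = a * w z + (w z - 1) * (G z - a) + (G z - a) := fun z => by ring
    simp_rw [this]
    rw [integral_add (f := fun z => a * w z + (w z - 1) * (G z - a)) (i1.add ip) i2,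
      integral_add i1 ip, integral_const_mul, integral_sub iG (integrable_const _), ← ha]
    simp
  rw [e]
  gcongr
  exact (le_abs_self _).trans (abs_integral_mul_le (hw.sub_const 1) (hG.sub_const a)
    (bounded_sub_const hb 1) (bounded_sub_const hGb a))

lemma lpNorm_backward_succ_le (hP : P.Invariant π) {w : S → ℝ} (hw : Measurable w)
    (hw0 : ∀ z, 0 ≤ w z) {W : ℝ} (hW : ∀ z, |w z| ≤ W) (k : ℕ) :
    lpNorm (fun z => backward P w (k + 1) z - ∫ v, backward P w (k + 1) v ∂π) 2 π ≤
      specLambda P π * ((∫ z, backward P w k z ∂π) * lpNorm (fun z => w z - 1) 2 π +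
        W * lpNorm (fun z => backward P w k z - ∫ v, backward P w k v ∂π) 2 π) := by
  have hb : ∃ C, ∀ z, |w z| ≤ C := ⟨W, hW⟩
  have hG := measurable_backward (P := P) hw k
  have hGb := bounded_backward (P := P) hb k
  have ha0 : 0 ≤ ∫ z, backward P w k z ∂π := integral_nonneg fun z => backward_nonneg hw0 k z
  rw [integral_backward_succ hP hw hb]
  change lpNorm (fun z => (∫ v, w v * backward P w k v ∂(P z)) - _) 2 π ≤ _
  set G := backward P w k
  set a := ∫ z, G z ∂π with ha
  have hwG : Measurable (fun z => w z * G z) := hw.mul hG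
  have hwGb : ∃ C, ∀ z, |w z * G z| ≤ C := bounded_mul hb hGb
  set c := ∫ z, w z * G z ∂π with hc
  have e1 : (fun z => (∫ v, w v * G v ∂(P z)) - c) = fun z => ∫ v, (w v * G v - c) ∂(P z) := by
    ext z
    rw [integral_sub (integrable_of_bounded hwG hwGb) (integrable_const _)]
    simp
  rw [e1]
  refine (lpNorm_kernel_le hP (hwG.sub_const c) (bounded_sub_const hwGb c) ?_).trans ?_
  · rw [integral_sub (integrable_of_bounded hwG hwGb) (integrable_const _)]
    simp [hc]
  refine mul_le_mul_of_nonneg_left ?_ (specLambda_nonneg P π)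
  -- Centring at `a`, the mean of `G`, rather than at `c` makes the difference split as `a (w - 1) +
  -- w (G - a)`.
  refine (lpNorm_sub_integral_le hwG hwGb a).trans ?_
  have e2 : (fun z => w z * G z - a) =
      (a • fun z => w z - 1) + fun z => w z * (G z - a) := by
    ext z
    simp only [Pi.add_apply, Pi.smul_apply, smul_eq_mul]
    ring
  rw [e2]
  refine (lpNorm_add_le ((memLp_two_of_bounded (hw.sub_const 1)
    (bounded_sub_const hb 1)).const_smul a) (by norm_num)).trans ?_
  rw [lpNorm_const_smul, coe_nnnorm, Real.norm_of_nonneg ha0]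
  gcongr
  exact lpNorm_mul_le hW hw (hG.sub_const a) (bounded_sub_const hGb a)

lemma exp_le_one_add_add_sq {x : ℝ} (hx : |x| ≤ 1) : Real.exp x ≤ 1 + x + x ^ 2 := by
  have := (abs_le.1 (Real.abs_exp_sub_one_sub_id_le hx)).2
  linarith

/-- With `a k` the mean of the `k`-th iterate and `b k` the norm of its centred part, the potential
`a k + c s (b k)` starts at `1` and grows by a factor at most `R` per step. -/
lemma integral_backward_le (hP : P.Invariant π) (hl : specLambda P π < 1) {f : S → ℝ}
    (hf : Measurable f) {M V θ : ℝ} (hM : ∀ z, |f z| ≤ M) (hf0 : ∫ z, f z ∂π = 0)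
    (hV : ∫ z, f z ^ 2 ∂π ≤ V) (hθ : 0 ≤ θ) (hθM : θ * M ≤ (1 - specLambda P π) / 4) (n : ℕ) :
    ∫ z, backward P (fun z => Real.exp (θ * f z)) n z ∂π ≤
      Real.exp (n * (9 * θ ^ 2 * V / (1 - specLambda P π))) := by
  set l := specLambda P π with hldef
  have hl0 : 0 ≤ l := specLambda_nonneg P π
  have hlp : 0 < 1 - l := by linarith
  set w : S → ℝ := fun z => Real.exp (θ * f z) with hwdef
  have hw : Measurable w := by fun_prop
  have hθf : ∀ z, |θ * f z| ≤ θ * M := fun z => by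
    rw [abs_mul, abs_of_nonneg hθ]
    exact mul_le_mul_of_nonneg_left (hM z) hθ
  have hθf1 : ∀ z, |θ * f z| ≤ 1 := fun z => (hθf z).trans (by linarith)
  have hM0 : 0 ≤ θ * M := by
    obtain ⟨z⟩ := π.nonempty_of_neZero
    exact (abs_nonneg _).trans (hθf z)
  have hW : ∀ z, |w z| ≤ Real.exp (θ * M) := fun z => by
    rw [hwdef, abs_of_pos (Real.exp_pos _)]
    exact Real.exp_le_exp.2 ((le_abs_self _).trans (hθf z))
  have hw0 : ∀ z, 0 ≤ w z := fun z => (Real.exp_pos _).le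
  have hb : ∃ C, ∀ z, |w z| ≤ C := ⟨_, hW⟩
  have if1 : Integrable f π := integrable_of_bounded hf ⟨M, hM⟩
  have if2 : Integrable (fun z => f z ^ 2) π := integrable_sq_of_bounded hf ⟨M, hM⟩
  have hV0 : 0 ≤ V := (integral_nonneg fun z => sq_nonneg (f z)).trans hV
  have hiw : ∫ z, w z ∂π ≤ 1 + θ ^ 2 * V := by
    have i1 : Integrable (fun z => 1 + θ * f z) π := (integrable_const _).add (if1.const_mul θ)
    have i2 : Integrable (fun z => θ ^ 2 * f z ^ 2) π := if2.const_mul _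
    calc ∫ z, w z ∂π ≤ ∫ z, (1 + θ * f z + θ ^ 2 * f z ^ 2) ∂π := by
          refine integral_mono (integrable_of_bounded hw hb) (i1.add i2) fun z => ?_
          have := exp_le_one_add_add_sq (hθf1 z)
          rw [mul_pow] at this
          exact this
      _ = 1 + θ ^ 2 * ∫ z, f z ^ 2 ∂π := by
          rw [integral_add i1 i2, integral_add (integrable_const _) (if1.const_mul θ),
            integral_const_mul, integral_const_mul, hf0]
          simp
      _ ≤ 1 + θ ^ 2 * V := by gcongr
  set s := lpNorm (fun z => w z - 1) 2 π with hs
  have hs0 : 0 ≤ s := lpNorm_nonneg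
  have hs2 : s ^ 2 ≤ 4 * θ ^ 2 * V := by
    rw [hs, lpNorm_two_sq (hw.sub_const 1)]
    calc ∫ z, (w z - 1) ^ 2 ∂π ≤ ∫ z, 4 * θ ^ 2 * f z ^ 2 ∂π := by
          refine integral_mono (integrable_sq_of_bounded (hw.sub_const 1)
            (bounded_sub_const hb 1)) (if2.const_mul _) fun z => ?_
          have := pow_le_pow_left₀ (abs_nonneg _) (Real.abs_exp_sub_one_le (hθf1 z)) 2
          rw [sq_abs, mul_pow, sq_abs, mul_pow] at this
          simp only [hwdef]
          linarith
      _ ≤ 4 * θ ^ 2 * V := by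
          rw [integral_const_mul]
          gcongr
  -- The restriction on `θ * M` ensures that multiplication by `w` uses up at most half of the gap.
  have hlW : l * Real.exp (θ * M) ≤ (1 + l) / 2 := by
    have h1 := exp_le_one_add_add_sq (x := θ * M) (by rw [abs_of_nonneg hM0]; linarith)
    have h2 : (θ * M) ^ 2 ≤ θ * M := by nlinarith
    have h3 : Real.exp (θ * M) ≤ 1 + (1 - l) / 2 := by linarith
    nlinarith [mul_le_mul_of_nonneg_left h3 hl0]
  set a : ℕ → ℝ := fun k => ∫ z, backward P w k z ∂π with ha
  set b : ℕ → ℝ := fun k => lpNorm (fun z => backward P w k z - a k) 2 π with hbdef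
  have ha0 : ∀ k, 0 ≤ a k := fun k => integral_nonneg fun z => backward_nonneg hw0 k z
  have hb0 : ∀ k, 0 ≤ b k := fun k => lpNorm_nonneg
  have ha1 : ∀ k, a (k + 1) ≤ a k * (1 + θ ^ 2 * V) + s * b k := fun k =>
    (integral_backward_succ_le hP hw hb k).trans
      (add_le_add_left (mul_le_mul_of_nonneg_left hiw (ha0 k)) _)
  have hb1 : ∀ k, b (k + 1) ≤ a k * s + (1 + l) / 2 * b k := fun k => by
    refine (lpNorm_backward_succ_le hP hw hw0 hW k).trans ?_
    have h1 := mul_le_mul_of_nonneg_right hlW (hb0 k)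
    have h2 := mul_le_mul_of_nonneg_right hl.le (mul_nonneg (ha0 k) hs0)
    simp only [ha, hbdef, hs, hldef] at h1 h2 ⊢
    linarith
  -- The solution of `1 + c (1 + l) / 2 = c`, so that the `b k` terms reproduce themselves exactly.
  set c := 2 / (1 - l) with hc
  have hc0 : 0 < c := by positivity
  have hcl : 1 + c * ((1 + l) / 2) = c := by
    rw [hc]
    field_simp
    ring
  set R := 1 + θ ^ 2 * V + c * s ^ 2 with hR
  have hR1 : 1 ≤ R := by
    have : 0 ≤ θ ^ 2 * V + c * s ^ 2 := by positivity
    linarith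
  have hΦ : ∀ k, a k + c * s * b k ≤ R ^ k := by
    intro k
    induction k with
    | zero =>
      have h1 : a 0 = 1 := by simp [ha, backward]
      have h2 : b 0 = 0 := by
        simp only [hbdef, h1]
        simp [backward]
      rw [h1, h2]
      simp
    | succ k ih =>
      calc a (k + 1) + c * s * b (k + 1)
          ≤ (a k * (1 + θ ^ 2 * V) + s * b k) + c * s * (a k * s + (1 + l) / 2 * b k) :=
            add_le_add (ha1 k) (mul_le_mul_of_nonneg_left (hb1 k) (by positivity))
        _ = R * a k + (1 + c * ((1 + l) / 2)) * s * b k := by rw [hR]; ring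
        _ = R * a k + 1 * (c * s * b k) := by rw [hcl]; ring
        _ ≤ R * a k + R * (c * s * b k) := by
            have := hb0 k
            gcongr
        _ = (a k + c * s * b k) * R := by ring
        _ ≤ R ^ k * R := mul_le_mul_of_nonneg_right ih (by linarith)
        _ = R ^ (k + 1) := (pow_succ _ _).symm
  have hRexp : R ≤ Real.exp (9 * θ ^ 2 * V / (1 - l)) := by
    refine le_trans ?_ (Real.add_one_le_exp _)
    have h1 : c * s ^ 2 ≤ 8 * (θ ^ 2 * V) / (1 - l) := by
      calc c * s ^ 2 ≤ c * (4 * θ ^ 2 * V) := by gcongr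
        _ = _ := by rw [hc]; ring
    have h2 : θ ^ 2 * V ≤ θ ^ 2 * V / (1 - l) := by
      rw [le_div_iff₀ hlp]
      nlinarith [mul_nonneg (mul_nonneg (sq_nonneg θ) hV0) hl0]
    calc R ≤ 1 + θ ^ 2 * V / (1 - l) + 8 * (θ ^ 2 * V) / (1 - l) := by rw [hR]; linarith
      _ = _ := by ring
  calc a n ≤ a n + c * s * b n := by
        have : 0 ≤ c * s * b n := mul_nonneg (mul_nonneg hc0.le hs0) (hb0 n)
        linarith
    _ ≤ R ^ n := hΦ n
    _ ≤ Real.exp (9 * θ ^ 2 * V / (1 - l)) ^ n := pow_le_pow_left₀ (by linarith) hRexp n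
    _ = _ := by rw [← Real.exp_nat_mul]

lemma IsStationaryMarkovChain.chernoff (hZ : IsStationaryMarkovChain P π μ Z)
    (hl : specLambda P π < 1) {f : S → ℝ} (hf : Measurable f) {M V θ : ℝ}
    (hM : ∀ z, |f z| ≤ M) (hf0 : ∫ z, f z ∂π = 0) (hV : ∫ z, f z ^ 2 ∂π ≤ V) (hθ : 0 ≤ θ)
    (hθM : θ * M ≤ (1 - specLambda P π) / 4) {n : ℕ} (hn : 0 < n) (a : ℝ) :
    μ.real {ω | a ≤ ∑ i ∈ Finset.range n, f (Z i ω)} ≤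
      Real.exp (-θ * a + n * (9 * θ ^ 2 * V / (1 - specLambda P π))) := by
  set w : S → ℝ := fun z => Real.exp (θ * f z) with hwdef
  have hw : Measurable w := by fun_prop
  have hW : ∀ z, |w z| ≤ Real.exp (θ * M) := fun z => by
    rw [hwdef, abs_of_pos (Real.exp_pos _)]
    exact Real.exp_le_exp.2 (mul_le_mul_of_nonneg_left ((le_abs_self _).trans (hM z)) hθ)
  have e : ∀ ω, Real.exp (θ * ∑ i ∈ Finset.range n, f (Z i ω)) =
      ∏ i ∈ Finset.range n, w (Z i ω) := fun ω => by
    rw [Finset.mul_sum, Real.exp_sum]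
  have hint : Integrable (fun ω => Real.exp (θ * ∑ i ∈ Finset.range n, f (Z i ω))) μ := by
    simp_rw [e]
    refine integrable_of_bounded
      (Finset.measurable_prod _ fun i _ => hw.comp (hZ.measurable i)) ?_
    exact bounded_prod _ fun i => ⟨_, fun ω => hW (Z i ω)⟩
  refine (measure_ge_le_exp_mul_mgf a hθ hint).trans ?_
  rw [Real.exp_add, mgf]
  gcongr
  simp_rw [e]
  rw [hZ.integral_prod_eq hw ⟨_, hW⟩ hn]
  exact integral_backward_le hZ.invariant hl hf hM hf0 hV hθ hθM n

/-- Bernstein's inequality for stationary Markov chains with an absolute spectral gap. -/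
lemma IsStationaryMarkovChain.bernstein (hZ : IsStationaryMarkovChain P π μ Z)
    (hl : specLambda P π < 1) {f : S → ℝ} (hf : Measurable f) {M V : ℝ} (hMpos : 0 < M)
    (hVpos : 0 < V) (hM : ∀ᵐ z ∂π, |f z| ≤ M) (hf0 : ∫ z, f z ∂π = 0)
    (hV : ∫ z, f z ^ 2 ∂π ≤ V) {n : ℕ} (hn : 0 < n) {s : ℝ} (hs : 0 < s) :
    μ.real {ω | 2 * Real.sqrt (9 * V * s / ((1 - specLambda P π) * n)) +
        4 * M * s / ((1 - specLambda P π) * n) ≤ (1 / (n : ℝ)) * ∑ i ∈ Finset.range n, f (Z i ω)} ≤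
      Real.exp (-s) := by
  set l := specLambda P π with hldef
  have hlp : 0 < 1 - l := by linarith
  have hnp : (0 : ℝ) < n := by exact_mod_cast hn
  set r := 2 * Real.sqrt (9 * V * s / ((1 - l) * n)) + 4 * M * s / ((1 - l) * n) with hr
  -- A version of `f` bounded everywhere, as the exponential moment argument needs.
  set g : S → ℝ := fun z => if |f z| ≤ M then f z else 0 with hg
  have hgm : Measurable g :=
    Measurable.ite (measurableSet_le (by fun_prop) measurable_const) hf measurable_const
  have hfg : ∀ᵐ z ∂π, f z = g z := hM.mono fun z hz => by simp [hg, hz]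
  have hgM : ∀ z, |g z| ≤ M := fun z => by
    by_cases h : |f z| ≤ M
    · simp [hg, h]
    · simp [hg, h, hMpos.le]
  have hg0 : ∫ z, g z ∂π = 0 := by rw [← hf0]; exact (integral_congr_ae hfg).symm
  have hgV : ∫ z, g z ^ 2 ∂π ≤ V :=
    (integral_congr_ae (hfg.mono fun z hz => by simp only [hz])).symm.le.trans hV
  have hae : ∀ᵐ ω ∂μ, ∀ i, f (Z i ω) = g (Z i ω) := by
    rw [ae_all_iff]
    intro i
    exact ae_of_ae_map (hZ.measurable i).aemeasurable (by rwa [hZ.map_eq i])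
  have hle : μ.real {ω | r ≤ (1 / (n : ℝ)) * ∑ i ∈ Finset.range n, f (Z i ω)} ≤
      μ.real {ω | r * n ≤ ∑ i ∈ Finset.range n, g (Z i ω)} := by
    refine ENNReal.toReal_mono (measure_ne_top _ _) (measure_mono_ae ?_)
    filter_upwards [hae] with ω hω
    intro (h : r ≤ _)
    change r * n ≤ _
    simp_rw [← hω]
    rwa [one_div, ← div_eq_inv_mul, le_div_iff₀ hnp] at h
  refine hle.trans ?_
  set q := Real.sqrt (9 * V * s / ((1 - l) * n)) with hq
  have hq0 : 0 < q := Real.sqrt_pos.2 (by positivity)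
  have hq2 : q ^ 2 = 9 * V * s / ((1 - l) * n) := Real.sq_sqrt (by positivity)
  -- The first entry makes the quadratic term at most `θ q n`, which one of the two copies of `q` in
  -- `r` pays for. Whichever entry is the minimum, the rest of `r` contributes at least `s`.
  set θ := min (s / (n * q)) ((1 - l) / (4 * M)) with hθ
  have hθ0 : 0 < θ := lt_min (by positivity) (by positivity)
  have hθ1 : θ ≤ s / (n * q) := min_le_left _ _
  have hθ2 : θ * M ≤ (1 - l) / 4 := by
    calc θ * M ≤ (1 - l) / (4 * M) * M := mul_le_mul_of_nonneg_right (min_le_right _ _) hMpos.le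
      _ = _ := by field_simp
  refine (hZ.chernoff hl hgm hgM hg0 hgV hθ0.le hθ2 hn _).trans (Real.exp_le_exp.2 ?_)
  have hVq : 9 * V / (1 - l) = q ^ 2 * n / s := by
    rw [hq2]
    field_simp
  have h1 : n * (9 * θ ^ 2 * V / (1 - l)) ≤ θ * q * n := by
    have : n * (9 * θ ^ 2 * V / (1 - l)) = θ * q * n * (θ * (n * q / s)) := by
      rw [show 9 * θ ^ 2 * V / (1 - l) = θ ^ 2 * (9 * V / (1 - l)) by ring, hVq]
      ring
    rw [this]
    refine mul_le_of_le_one_right (by positivity) ?_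
    calc θ * (n * q / s) ≤ s / (n * q) * (n * q / s) := by gcongr
      _ = 1 := by field_simp
  have h2 : s ≤ θ * (q + 4 * M * s / ((1 - l) * n)) * n := by
    rcases min_choice (s / (n * q)) ((1 - l) / (4 * M)) with h | h
    · have e1 : θ * q * n = s := by rw [hθ, h]; field_simp
      have e2 : 0 ≤ θ * (4 * M * s / ((1 - l) * n)) * n := by positivity
      linarith
    · have e1 : θ * (4 * M * s / ((1 - l) * n)) * n = s := by rw [hθ, h]; field_simp
      have e2 : 0 ≤ θ * q * n := by positivity
      linarith
  rw [hr]
  linarith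

end Bernstein

/-! ### A finite set of directions detecting the norm -/

section Net

variable {E : Type*} [NormedAddCommGroup E] [InnerProductSpace ℝ E] [FiniteDimensional ℝ E]

variable (E) in
-- A maximal 1-separated subset of the sphere of radius `2` has at most `5 ^ dim` points. By
-- maximality, each `w` on that sphere is within `1` of some `c` in it, which costs at most half of
-- `⟨w, v⟩ = 2 ‖v‖`; finally the points are halved.
lemma exists_finset_half_norm_le_inner :
    ∃ N : Finset E, N.card ≤ 5 ^ Module.finrank ℝ E ∧ (∀ u ∈ N, ‖u‖ = 1) ∧
      ∀ v : E, v ≠ 0 → ∃ u ∈ N, ‖v‖ / 2 ≤ inner ℝ u v := by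
  classical
  let Q : ℕ → Prop := fun k => ∃ s : Finset E, (∀ c ∈ s, ‖c‖ = 2) ∧
    (∀ c ∈ s, ∀ d ∈ s, c ≠ d → 1 ≤ ‖c - d‖) ∧ s.card = k
  have hbound : ∀ k, Q k → k ≤ 5 ^ Module.finrank ℝ E := by
    rintro k ⟨s, h2, hs, rfl⟩
    exact Besicovitch.card_le_of_separated s (fun c hc => (h2 c hc).le) hs
  have h0 : Q 0 := ⟨∅, by simp, by simp, rfl⟩
  obtain ⟨s, h2, hs, hcard⟩ := Nat.findGreatest_spec (P := Q) (Nat.zero_le _) h0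
  have hmax : ∀ k, Q k → k ≤ s.card := fun k hk => by
    rw [hcard]
    exact Nat.le_findGreatest (hbound k hk) hk
  refine ⟨s.image fun c => (1 / 2 : ℝ) • c,
    Finset.card_image_le.trans (hbound _ ⟨s, h2, hs, rfl⟩), ?_, fun v hv => ?_⟩
  · intro u hu
    obtain ⟨c, hc, rfl⟩ := Finset.mem_image.1 hu
    rw [norm_smul, h2 c hc]
    norm_num
  · have hvn : 0 < ‖v‖ := norm_pos_iff.2 hv
    set w : E := (2 / ‖v‖) • v with hw
    have hwn : ‖w‖ = 2 := by
      rw [hw, norm_smul, Real.norm_of_nonneg (by positivity)]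
      field_simp
    have hvw : inner ℝ w v = 2 * ‖v‖ := by
      rw [hw, real_inner_smul_left, real_inner_self_eq_norm_sq]
      field_simp
    have : ∃ c ∈ s, ‖c - w‖ ≤ 1 := by
      by_contra! hcon
      have hws : w ∉ s := fun h => by
        have := hcon w h
        simp at this
        linarith
      have := hmax (s.card + 1) ⟨insert w s, ?_, ?_, Finset.card_insert_of_notMem hws⟩
      · omega
      · intro c hc
        rcases Finset.mem_insert.1 hc with rfl | hc
        · exact hwn
        · exact h2 c hc
      · intro c hc d hd hcd
        rcases Finset.mem_insert.1 hc with rfl | hc <;> rcases Finset.mem_insert.1 hd with rfl | hd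
        · exact absurd rfl hcd
        · rw [norm_sub_rev]
          exact (hcon d hd).le
        · exact (hcon c hc).le
        · exact hs c hc d hd hcd
    obtain ⟨c, hc, hcw⟩ := this
    refine ⟨_, Finset.mem_image_of_mem _ hc, ?_⟩
    have h1 : inner ℝ c v = inner ℝ (c - w) v + 2 * ‖v‖ := by rw [← hvw, ← inner_add_left]; simp
    have h2 := (abs_le.1 (abs_real_inner_le_norm (c - w) v)).1
    have h3 : ‖c - w‖ * ‖v‖ ≤ 1 * ‖v‖ := by gcongr
    rw [real_inner_smul_left]
    linarith

end Net

/-! ### Huber loss, its derivative and truncation bounds -/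

section Huber

/-- The derivative of the Huber loss, that is `x` clipped to `[-τ, τ]`. -/
def huberScore (τ x : ℝ) : ℝ := x - max (x - τ) 0 + max (-x - τ) 0

lemma hasDerivAt_max_zero_sq_div_two (x : ℝ) :
    HasDerivAt (fun u : ℝ => max u 0 ^ 2 / 2) (max x 0) x := by
  have hne : ∀ y : ℝ, y ≠ 0 → HasDerivAt (fun u : ℝ => max u 0 ^ 2 / 2) (max y 0) y := by
    intro y hy
    rcases lt_or_gt_of_ne hy with h | h
    · rw [max_eq_right h.le]
      refine (hasDerivAt_const y (0 : ℝ)).congr_of_eventuallyEq ?_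
      filter_upwards [Iio_mem_nhds h] with u hu
      rw [max_eq_right (le_of_lt hu)]
      simp
    · rw [max_eq_left h.le]
      have := (hasDerivAt_pow 2 y).div_const 2
      refine (this.congr_deriv (by simp)).congr_of_eventuallyEq ?_
      filter_upwards [Ioi_mem_nhds h] with u hu
      rw [max_eq_left (le_of_lt hu)]
  rcases eq_or_ne x 0 with rfl | hx
  · exact hasDerivAt_of_hasDerivAt_of_ne (g := fun y => max y 0) hne (by fun_prop) (by fun_prop)
  · exact hne x hx

/-- Writing the loss as a parabola minus two squared hinges gives differentiability at `±τ` without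
case distinctions. -/
lemma huberLoss_eq {τ : ℝ} (hτ : 0 < τ) (x : ℝ) :
    huberLoss τ x = x ^ 2 / 2 - max (x - τ) 0 ^ 2 / 2 - max (-x - τ) 0 ^ 2 / 2 := by
  unfold huberLoss
  split_ifs with h
  · rw [abs_le] at h
    rw [max_eq_right (by linarith), max_eq_right (by linarith)]
    ring
  · rcases le_total 0 x with hx | hx
    · rw [abs_of_nonneg hx] at h ⊢
      rw [max_eq_left (by linarith), max_eq_right (by linarith)]
      ring
    · rw [abs_of_nonpos hx] at h ⊢
      rw [max_eq_right (by linarith), max_eq_left (by linarith)]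
      ring

lemma hasDerivAt_huberLoss {τ : ℝ} (hτ : 0 < τ) (x : ℝ) :
    HasDerivAt (huberLoss τ) (huberScore τ x) x := by
  have e : huberLoss τ =
      fun x => x ^ 2 / 2 - max (x - τ) 0 ^ 2 / 2 - max (-x - τ) 0 ^ 2 / 2 :=
    funext (huberLoss_eq hτ)
  rw [e]
  have h1 : HasDerivAt (fun x : ℝ => x ^ 2 / 2) x x :=
    ((hasDerivAt_pow 2 x).div_const 2).congr_deriv (by simp)
  have h2 : HasDerivAt (fun x : ℝ => max (x - τ) 0 ^ 2 / 2) (max (x - τ) 0 * 1) x :=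
    HasDerivAt.comp (h₂ := fun u : ℝ => max u 0 ^ 2 / 2) x (hasDerivAt_max_zero_sq_div_two (x - τ))
      ((hasDerivAt_id x).sub_const τ)
  have h3 : HasDerivAt (fun x : ℝ => max (-x - τ) 0 ^ 2 / 2) (max (-x - τ) 0 * -1) x :=
    HasDerivAt.comp (h₂ := fun u : ℝ => max u 0 ^ 2 / 2) x (hasDerivAt_max_zero_sq_div_two (-x - τ))
      ((hasDerivAt_id x).neg.sub_const τ)
  exact ((h1.sub h2).sub h3).congr_deriv (by unfold huberScore; ring)

@[fun_prop]
lemma continuous_huberScore (τ : ℝ) : Continuous (huberScore τ) := by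
  unfold huberScore
  fun_prop

lemma huberScore_of_abs_le {τ x : ℝ} (h : |x| ≤ τ) : huberScore τ x = x := by
  rw [abs_le] at h
  rw [huberScore, max_eq_right (by linarith), max_eq_right (by linarith)]
  ring

lemma huberScore_of_lt {τ x : ℝ} (hτ : 0 < τ) (h : τ < x) : huberScore τ x = τ := by
  rw [huberScore, max_eq_left (by linarith), max_eq_right (by linarith)]
  ring

lemma huberScore_of_lt_neg {τ x : ℝ} (hτ : 0 < τ) (h : x < -τ) : huberScore τ x = -τ := by
  rw [huberScore, max_eq_right (by linarith), max_eq_left (by linarith)]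
  ring

lemma abs_huberScore {τ : ℝ} (hτ : 0 < τ) (x : ℝ) : |huberScore τ x| = min |x| τ := by
  rcases le_or_gt |x| τ with h | h
  · rw [huberScore_of_abs_le h, min_eq_left h]
  · rw [min_eq_right h.le]
    rcases lt_abs.1 h with h | h
    · rw [huberScore_of_lt hτ h, abs_of_pos hτ]
    · rw [huberScore_of_lt_neg hτ (by linarith), abs_neg, abs_of_pos hτ]

/-- The square of `min |x| τ` is split into powers `1 - δ` and `1 + δ`, bounded by `τ` and `|x|`
respectively. -/
lemma huberScore_sq_le {τ δ : ℝ} (hτ : 0 < τ) (hδ : 0 < δ) (hδ1 : δ ≤ 1) (x : ℝ) :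
    huberScore τ x ^ 2 ≤ τ ^ (1 - δ) * |x| ^ (1 + δ) := by
  set a := |huberScore τ x| with ha
  have ha0 : 0 ≤ a := abs_nonneg _
  have h := abs_huberScore hτ x
  have h1 : a ≤ |x| := h.le.trans (min_le_left _ _)
  have h2 : a ≤ τ := h.le.trans (min_le_right _ _)
  calc huberScore τ x ^ 2 = a ^ ((1 - δ) + (1 + δ)) := by
        rw [← sq_abs, ← ha, ← Real.rpow_natCast]
        norm_num
    _ = a ^ (1 - δ) * a ^ (1 + δ) :=
        Real.rpow_add_of_nonneg ha0 (by linarith) (by linarith)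
    _ ≤ τ ^ (1 - δ) * |x| ^ (1 + δ) := by
        gcongr

/-- Nothing is lost when `|x| ≤ τ`; otherwise the loss is at most `|x|`, and `(|x| / τ) ^ δ ≥ 1`. -/
lemma abs_huberScore_sub_le {τ δ : ℝ} (hτ : 0 < τ) (hδ : 0 < δ) (x : ℝ) :
    |huberScore τ x - x| ≤ τ ^ (-δ) * |x| ^ (1 + δ) := by
  rcases le_or_gt |x| τ with h | h
  · rw [huberScore_of_abs_le h, sub_self, abs_zero]
    positivity
  · have hx : 0 < |x| := hτ.trans h
    have h1 : |huberScore τ x - x| ≤ |x| := by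
      rcases lt_abs.1 h with h | h
      · rw [huberScore_of_lt hτ h, abs_of_nonpos (by linarith), abs_of_pos (hτ.trans h)]
        linarith
      · rw [huberScore_of_lt_neg hτ (by linarith), abs_of_nonneg (by linarith),
          abs_of_neg (by linarith)]
        linarith
    calc |huberScore τ x - x| ≤ |x| := h1
      _ = |x| ^ (-δ) * |x| ^ (1 + δ) := by
          rw [← Real.rpow_add hx]
          simp
      _ ≤ τ ^ (-δ) * |x| ^ (1 + δ) := by
          refine mul_le_mul_of_nonneg_right ?_ (by positivity)
          exact Real.rpow_le_rpow_of_nonpos hτ h.le (by linarith)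

lemma hasGradientAt_empiricalLoss {d : ℕ} {τ : ℝ} (hτ : 0 < τ) (n : ℕ)
    (xs : ℕ → EuclideanSpace ℝ (Fin d)) (ys : ℕ → ℝ) (β : EuclideanSpace ℝ (Fin d)) :
    HasGradientAt (empiricalLoss τ n xs ys)
      (-((1 / (n : ℝ)) • ∑ i ∈ Finset.range n,
        huberScore τ (ys i - inner ℝ (xs i) β) • xs i)) β := by
  rw [hasGradientAt_iff_hasFDerivAt]
  have h : ∀ i, HasFDerivAt (fun β => huberLoss τ (ys i - inner ℝ (xs i) β))
      (huberScore τ (ys i - inner ℝ (xs i) β) • -(innerSL ℝ (xs i))) β := fun i =>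
    (hasDerivAt_huberLoss hτ _).comp_hasFDerivAt β
      ((innerSL ℝ (xs i)).hasFDerivAt.const_sub (ys i))
  have hs := (HasFDerivAt.fun_sum (u := Finset.range n) fun i _ => h i).const_mul (1 / (n : ℝ))
  refine hs.congr_fderiv ?_
  ext v
  simp [Finset.sum_neg_distrib]

end Huber

/-! ### Whitened covariates -/

section Whitening

variable {d : ℕ}

open scoped MatrixOrder in
lemma invSqrt_isHermitian (A : Matrix (Fin d) (Fin d) ℝ) : (invSqrt A).IsHermitian :=
  (Matrix.nonneg_iff_posSemidef.1 (CFC.sqrt_nonneg A⁻¹)).1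

open scoped MatrixOrder in
lemma invSqrt_mul_self {A : Matrix (Fin d) (Fin d) ℝ} (hA : A.PosDef) :
    invSqrt A * invSqrt A = A⁻¹ :=
  CFC.sqrt_mul_sqrt_self _ (Matrix.nonneg_iff_posSemidef.2 hA.inv.posSemidef)

lemma invSqrt_mul_mul_invSqrt {A : Matrix (Fin d) (Fin d) ℝ} (hA : A.PosDef) :
    invSqrt A * A * invSqrt A = 1 := by
  have h : invSqrt A * (invSqrt A * A) = 1 := by
    rw [← mul_assoc, invSqrt_mul_self hA, Matrix.nonsing_inv_mul _ hA.det_pos.ne'.isUnit]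
  exact mul_eq_one_comm.1 h

lemma inner_whiten (A : Matrix (Fin d) (Fin d) ℝ) (u v : EuclideanSpace ℝ (Fin d)) :
    inner ℝ u (whiten A v) = inner ℝ (whiten A u) v := by
  rw [real_inner_comm v, whiten, whiten, Matrix.inner_toEuclideanCLM,
    Matrix.inner_toEuclideanCLM, Matrix.dotProduct_mulVec, ← Matrix.mulVec_transpose,
    show (invSqrt A).transpose = invSqrt A from invSqrt_isHermitian A, dotProduct_comm]

/-- Undoing the whitening bounds `x` itself, which makes the entries of the second moment matrix
genuine integrals. -/
lemma norm_le_of_norm_whiten_le {A : Matrix (Fin d) (Fin d) ℝ} (hA : A.PosDef) {K : ℝ}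
    {v : EuclideanSpace ℝ (Fin d)} (h : ‖whiten A v‖ ≤ K) :
    ‖v‖ ≤ ‖Matrix.toEuclideanCLM (𝕜 := ℝ) (A * invSqrt A)‖ * K := by
  have e : v = Matrix.toEuclideanCLM (𝕜 := ℝ) (A * invSqrt A) (whiten A v) := by
    rw [whiten, ← mul_apply_eq_comp, ← map_mul, mul_assoc, invSqrt_mul_self hA,
      Matrix.mul_nonsing_inv _ hA.det_pos.ne'.isUnit, map_one, one_apply_eq_self]
  conv_lhs => rw [e]
  exact (ContinuousLinearMap.le_opNorm _ _).trans (by gcongr)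

@[fun_prop]
lemma continuous_whiten (A : Matrix (Fin d) (Fin d) ℝ) : Continuous (whiten A) :=
  (Matrix.toEuclideanCLM (𝕜 := ℝ) (invSqrt A)).continuous

variable {S : Type*} [MeasurableSpace S] {π : Measure S} [IsProbabilityMeasure π]

lemma integral_inner_sq {x : S → EuclideanSpace ℝ (Fin d)} (hx : Measurable x) {C : ℝ}
    (hC : ∀ᵐ z ∂π, ‖x z‖ ≤ C) (v : EuclideanSpace ℝ (Fin d)) :
    ∫ z, inner ℝ v (x z) ^ 2 ∂π = v.ofLp ⬝ᵥ (secondMoment π x).mulVec v.ofLp := by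
  have hint : ∀ i j, Integrable (fun z => x z i * x z j) π := fun i j => by
    refine Integrable.of_bound (by fun_prop) (C * C) ?_
    filter_upwards [hC] with z hz
    rw [norm_mul]
    have h1 := (PiLp.norm_apply_le (x z) i).trans hz
    have h2 := (PiLp.norm_apply_le (x z) j).trans hz
    exact mul_le_mul h1 h2 (norm_nonneg _) ((norm_nonneg _).trans h1)
  have e : ∀ z, inner ℝ v (x z) ^ 2 = ∑ i, ∑ j, v i * v j * (x z i * x z j) := fun z => by
    rw [PiLp.inner_apply, sq, Finset.sum_mul_sum]
    refine Finset.sum_congr rfl fun i _ => Finset.sum_congr rfl fun j _ => ?_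
    simp
    ring
  simp_rw [e]
  rw [integral_finsetSum _ fun i _ => integrable_finsetSum _ fun j _ => (hint i j).const_mul _]
  simp_rw [dotProduct, Matrix.mulVec, dotProduct, Finset.mul_sum]
  refine Finset.sum_congr rfl fun i _ => ?_
  rw [integral_finsetSum _ fun j _ => (hint i j).const_mul _]
  refine Finset.sum_congr rfl fun j _ => ?_
  rw [integral_const_mul, secondMoment, Matrix.of_apply]
  ring

lemma integral_inner_whiten_sq {x : S → EuclideanSpace ℝ (Fin d)} (hx : Measurable x)
    (hA : (secondMoment π x).PosDef) {K : ℝ}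
    (hK : ∀ᵐ z ∂π, ‖whiten (secondMoment π x) (x z)‖ ≤ K) (u : EuclideanSpace ℝ (Fin d)) :
    ∫ z, inner ℝ u (whiten (secondMoment π x) (x z)) ^ 2 ∂π = ‖u‖ ^ 2 := by
  simp_rw [inner_whiten]
  rw [integral_inner_sq hx (hK.mono fun z hz => norm_le_of_norm_whiten_le hA hz)]
  set A := secondMoment π x
  have h1 : (whiten A u).ofLp ⬝ᵥ A.mulVec (whiten A u).ofLp =
      inner ℝ (whiten A u) (Matrix.toEuclideanCLM (𝕜 := ℝ) A (whiten A u)) := by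
    rw [Matrix.inner_toEuclideanCLM]
  rw [h1, ← inner_whiten, ← real_inner_self_eq_norm_sq]
  congr 1
  rw [whiten, whiten, ← mul_apply_eq_comp, ← map_mul, ← mul_apply_eq_comp,
    ← map_mul, invSqrt_mul_mul_invSqrt hA, map_one, one_apply_eq_self]

/-- Above `K` the event is null; up to `K` the right side is at least `1`. -/
lemma measureReal_le_abs_inner_whiten {x : S → EuclideanSpace ℝ (Fin d)}
    {A : Matrix (Fin d) (Fin d) ℝ} {K : ℝ} (hK1 : 1 ≤ K)
    (hK : ∀ᵐ z ∂π, ‖whiten A (x z)‖ ≤ K) {u : EuclideanSpace ℝ (Fin d)} (hu : ‖u‖ = 1) {p : ℝ}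
    (hp : 0 ≤ p) :
    π.real {z | p ≤ |inner ℝ u (whiten A (x z))|} ≤ 2 * Real.exp (-(p ^ 2 / (24 * K) ^ 2)) := by
  rcases le_or_gt p K with h | h
  · refine (measureReal_le_one).trans ?_
    have h1 : p ^ 2 / (24 * K) ^ 2 ≤ 1 / 2 := by
      rw [div_le_iff₀ (by positivity)]
      nlinarith
    have h2 : 1 / 2 ≤ Real.exp (-(p ^ 2 / (24 * K) ^ 2)) := by
      linarith [Real.add_one_le_exp (-(p ^ 2 / (24 * K) ^ 2))]
    linarith
  · have h0 : π {z | p ≤ |inner ℝ u (whiten A (x z))|} = 0 := by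
      rw [measure_eq_zero_iff_ae_notMem]
      filter_upwards [hK] with z hz
      have := abs_real_inner_le_norm u (whiten A (x z))
      rw [hu, one_mul] at this
      exact not_le.2 ((this.trans hz).trans_lt h)
    rw [Measure.real, h0]
    simp only [ENNReal.toReal_zero]
    positivity

end Whitening

/-! ### Variance and bias of the truncated score -/

section Moments

variable {S : Type*} {m : MeasurableSpace S} [mS : MeasurableSpace S] {π : Measure S}
  [IsProbabilityMeasure π]

lemma integral_mul_eq_integral_mul_condExp (hm : m ≤ mS) {g e : S → ℝ}
    (hg : StronglyMeasurable[m] g) {C : ℝ} (hC : ∀ᵐ z ∂π, |g z| ≤ C) (he : Integrable e π) :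
    ∫ z, g z * e z ∂π = ∫ z, g z * (π[e | m]) z ∂π := by
  have h := condExp_stronglyMeasurable_mul_of_bound hm hg he C hC
  rw [← integral_condExp hm]
  exact integral_congr_ae h

lemma integral_mul_le_of_condExp_le (hm : m ≤ mS) {g e : S → ℝ}
    (hg : StronglyMeasurable[m] g) {C : ℝ} (hC : ∀ᵐ z ∂π, |g z| ≤ C) (hg0 : ∀ z, 0 ≤ g z)
    (he : Integrable e π) {v : ℝ} (hv : ∀ᵐ z ∂π, (π[e | m]) z ≤ v) :
    ∫ z, g z * e z ∂π ≤ v * ∫ z, g z ∂π := by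
  have hgm : AEStronglyMeasurable g π := (hg.mono hm).aestronglyMeasurable
  rw [integral_mul_eq_integral_mul_condExp hm hg hC he, ← integral_const_mul]
  refine integral_mono_ae (integrable_condExp.bdd_mul hgm hC)
    ((Integrable.of_bound hgm C hC).const_mul v) ?_
  filter_upwards [hv] with z hz
  rw [mul_comm v]
  exact mul_le_mul_of_nonneg_left hz (hg0 z)

lemma integrable_of_integrable_abs_rpow {ε : S → ℝ} (hε : Measurable ε) {δ : ℝ} (hδ : 0 < δ)
    (h : Integrable (fun z => |ε z| ^ (1 + δ)) π) : Integrable ε π := by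
  refine ((integrable_const (1 : ℝ)).add h).mono' hε.aestronglyMeasurable
    (Filter.Eventually.of_forall fun z => ?_)
  rw [Real.norm_eq_abs, Pi.add_apply]
  rcases le_total |ε z| 1 with h1 | h1
  · have : 0 ≤ |ε z| ^ (1 + δ) := by positivity
    linarith
  · have := Real.rpow_le_rpow_of_exponent_le h1 (show (1 : ℝ) ≤ 1 + δ by linarith)
    rw [Real.rpow_one] at this
    linarith

variable {ε q : S → ℝ} {δ v τ K : ℝ}

lemma integral_huberScore_mul_sq_le (hm : m ≤ mS) (hq : StronglyMeasurable[m] q)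
    (hK : ∀ᵐ z ∂π, |q z| ≤ K) (hq2 : ∫ z, q z ^ 2 ∂π = 1) (hτ : 0 < τ) (hδ : 0 < δ) (hδ1 : δ ≤ 1)
    (hint : Integrable (fun z => |ε z| ^ (1 + δ)) π)
    (hv : ∀ᵐ z ∂π, (π[fun z => |ε z| ^ (1 + δ) | m]) z ≤ v) :
    ∫ z, (huberScore τ (ε z) * q z) ^ 2 ∂π ≤ v * τ ^ (1 - δ) := by
  have hqm : AEStronglyMeasurable q π := (hq.mono hm).aestronglyMeasurable
  have hK2 : ∀ᵐ z ∂π, |q z ^ 2| ≤ K ^ 2 := hK.mono fun z hz => by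
    rw [abs_pow]
    exact pow_le_pow_left₀ (abs_nonneg _) hz 2
  have h1 := integral_mul_le_of_condExp_le hm (g := fun z => q z ^ 2) (hq.pow 2) hK2 (fun z => sq_nonneg (q z)) hint hv
  have i1 : Integrable (fun z => q z ^ 2 * |ε z| ^ (1 + δ)) π := hint.bdd_mul (hqm.pow 2) hK2
  calc ∫ z, (huberScore τ (ε z) * q z) ^ 2 ∂π
      ≤ ∫ z, τ ^ (1 - δ) * (q z ^ 2 * |ε z| ^ (1 + δ)) ∂π := by
        refine integral_mono_of_nonneg (Filter.Eventually.of_forall fun z => sq_nonneg _)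
          (i1.const_mul _) (Filter.Eventually.of_forall fun z => ?_)
        have := mul_le_mul_of_nonneg_right (huberScore_sq_le hτ hδ hδ1 (ε z)) (sq_nonneg (q z))
        simp only [mul_pow]
        linarith
    _ = τ ^ (1 - δ) * ∫ z, q z ^ 2 * |ε z| ^ (1 + δ) ∂π := integral_const_mul _ _
    _ ≤ τ ^ (1 - δ) * (v * ∫ z, q z ^ 2 ∂π) := mul_le_mul_of_nonneg_left h1 (by positivity)
    _ = _ := by rw [hq2]; ring

lemma abs_integral_huberScore_mul_le (hm : m ≤ mS) (hε : Measurable ε)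
    (hq : StronglyMeasurable[m] q) (hK : ∀ᵐ z ∂π, |q z| ≤ K) (hq2 : ∫ z, q z ^ 2 ∂π = 1)
    (hτ : 0 < τ) (hδ : 0 < δ) (hv0 : 0 < v) (h0 : π[ε | m] =ᵐ[π] fun _ => (0 : ℝ))
    (hint : Integrable (fun z => |ε z| ^ (1 + δ)) π)
    (hv : ∀ᵐ z ∂π, (π[fun z => |ε z| ^ (1 + δ) | m]) z ≤ v) :
    |∫ z, huberScore τ (ε z) * q z ∂π| ≤ v * τ ^ (-δ) := by
  have hqm : AEStronglyMeasurable q π := (hq.mono hm).aestronglyMeasurable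
  have iε := integrable_of_integrable_abs_rpow hε hδ hint
  have iq : Integrable q π := Integrable.of_bound hqm K hK
  have iqε : Integrable (fun z => q z * ε z) π := iε.bdd_mul hqm hK
  have hsm : Measurable fun z => huberScore τ (ε z) := by fun_prop
  have iψq : Integrable (fun z => huberScore τ (ε z) * q z) π :=
    iq.bdd_mul hsm.aestronglyMeasurable (Filter.Eventually.of_forall fun z =>
      (abs_huberScore hτ (ε z)).le.trans (min_le_right _ _))
  have hεq : ∫ z, q z * ε z ∂π = 0 := by
    rw [integral_mul_eq_integral_mul_condExp hm hq hK iε,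
      integral_congr_ae (g := fun _ => (0 : ℝ)) (h0.mono fun z hz => by simp [hz])]
    simp
  have hKa : ∀ᵐ z ∂π, |(|q z|)| ≤ K := hK.mono fun z hz => by rwa [abs_abs]
  have h1 := integral_mul_le_of_condExp_le hm (g := fun z => |q z|) hq.norm hKa
    (fun z => abs_nonneg (q z)) hint hv
  have iq2 : Integrable (fun z => q z ^ 2) π := by
    refine Integrable.of_bound (hqm.pow 2) (K ^ 2) (hK.mono fun z hz => ?_)
    rw [norm_pow]
    exact pow_le_pow_left₀ (abs_nonneg _) hz 2
  have hq1 : ∫ z, |q z| ∂π ≤ 1 := by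
    calc ∫ z, |q z| ∂π ≤ ∫ z, (1 + q z ^ 2) / 2 ∂π := by
          refine integral_mono iq.abs (((integrable_const _).add iq2).div_const 2) fun z => ?_
          have := two_mul_le_add_sq 1 |q z|
          rw [sq_abs] at this
          simp only
          linarith
      _ = 1 := by
          rw [integral_div, integral_add (integrable_const _) iq2, hq2]
          simp
  have i1 : Integrable (fun z => |q z| * |ε z| ^ (1 + δ)) π := hint.bdd_mul hqm.norm hKa
  -- Conditional mean zero allows `ε` to be subtracted, leaving only the truncation error.
  have e : ∫ z, huberScore τ (ε z) * q z ∂π = ∫ z, (huberScore τ (ε z) - ε z) * q z ∂π := by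
    have : ∀ z, (huberScore τ (ε z) - ε z) * q z = huberScore τ (ε z) * q z - q z * ε z :=
      fun z => by ring
    simp_rw [this]
    rw [integral_sub iψq iqε, hεq, sub_zero]
  rw [e]
  calc |∫ z, (huberScore τ (ε z) - ε z) * q z ∂π|
      ≤ ∫ z, |(huberScore τ (ε z) - ε z) * q z| ∂π := abs_integral_le_integral_abs
    _ ≤ ∫ z, τ ^ (-δ) * (|q z| * |ε z| ^ (1 + δ)) ∂π := by
        refine integral_mono_of_nonneg (Filter.Eventually.of_forall fun z => abs_nonneg _)
          (i1.const_mul _) (Filter.Eventually.of_forall fun z => ?_)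
        have := mul_le_mul_of_nonneg_right (abs_huberScore_sub_le hτ hδ (ε z)) (abs_nonneg (q z))
        simp only [abs_mul]
        linarith
    _ = τ ^ (-δ) * ∫ z, |q z| * |ε z| ^ (1 + δ) ∂π := integral_const_mul _ _
    _ ≤ τ ^ (-δ) * (v * 1) := by
        refine mul_le_mul_of_nonneg_left (h1.trans ?_) (by positivity)
        exact mul_le_mul_of_nonneg_left hq1 hv0.le
    _ = _ := by ring

end Moments

/-- Here the factor `24` is fixed: the linear term needs `96 = 4 * 24`, using only `√π ≥ 1` and `A2
l ≥ 1 / (3 (1 - l))`, an equality at `l = 0`. The square root term has ample room. As `specLambda`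
is nonnegative, the first branch of `A2` occurs only at `l = 0`. -/
lemma bernstein_constants_le {κ l V D τ n : ℝ} (hκ : 1 ≤ κ) (hl0 : 0 ≤ l) (hl : l < 1)
    (hV : 0 ≤ V) (hD : 0 ≤ D) (hτ : 0 ≤ τ) (hn : 0 < n) :
    2 * (2 * √(9 * V * (2 * D) / ((1 - l) * n)) + 4 * (2 * τ * κ) * (2 * D) / ((1 - l) * n)) ≤
      4 * √Real.pi * (24 * κ) * A2 l * D * τ / n + 4 * (24 * κ) * √(A1 l * V * D / n) := by
  have hlp : 0 < 1 - l := by linarith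
  have h1 : √(9 * V * (2 * D) / ((1 - l) * n)) ≤ 24 * κ * √(A1 l * V * D / n) := by
    rw [← Real.sqrt_sq (show 0 ≤ 24 * κ by positivity), ← Real.sqrt_mul (sq_nonneg _)]
    refine Real.sqrt_le_sqrt ?_
    have e1 : 9 * V * (2 * D) / ((1 - l) * n) = 18 * (V * D / ((1 - l) * n)) := by ring
    have e2 : (24 * κ) ^ 2 * (A1 l * V * D / n) =
        (24 * κ) ^ 2 * (1 + l) * (V * D / ((1 - l) * n)) := by
      rw [A1]
      field_simp
    rw [e1, e2]
    refine mul_le_mul_of_nonneg_right ?_ (by positivity)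
    nlinarith
  have hA2 : 1 / (3 * (1 - l)) ≤ A2 l := by
    unfold A2
    split_ifs with h
    · have : l = 0 := le_antisymm h hl0
      simp [this]
    · rw [div_le_div_iff₀ (by positivity) hlp]
      linarith
  have hpi : 1 ≤ √Real.pi := Real.one_le_sqrt.2 (by linarith [Real.pi_gt_three])
  have h2 : 1 / (3 * (1 - l)) ≤ √Real.pi * A2 l :=
    hA2.trans (le_mul_of_one_le_left (le_trans (by positivity) hA2) hpi)
  have h3 : 2 * (4 * (2 * τ * κ) * (2 * D) / ((1 - l) * n)) ≤
      4 * √Real.pi * (24 * κ) * A2 l * D * τ / n := by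
    calc 2 * (4 * (2 * τ * κ) * (2 * D) / ((1 - l) * n))
        = 96 * κ * D * τ / n * (1 / (3 * (1 - l))) := by
          field_simp
          ring
      _ ≤ 96 * κ * D * τ / n * (√Real.pi * A2 l) := by gcongr
      _ = _ := by ring
  linarith

/-! ### Concentration of the whitened score -/

section Score

variable {S Ω : Type*} [MeasurableSpace S] [MeasurableSpace Ω] {P : Kernel S S} [IsMarkovKernel P]
  {π : Measure S} [IsProbabilityMeasure π] {μ : Measure Ω} [IsProbabilityMeasure μ]
  {Z : ℕ → Ω → S}

/-- Concentration of a vector-valued empirical mean, given Bernstein parameters valid uniformly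
over all directions. -/
lemma IsStationaryMarkovChain.norm_average_sub_integral_bound
    (hZ : IsStationaryMarkovChain P π μ Z) (hl : specLambda P π < 1) {d : ℕ}
    {F : S → EuclideanSpace ℝ (Fin d)} (hF : Measurable F) {B V : ℝ} (hB : 0 < B) (hV : 0 < V)
    (hFB : ∀ᵐ z ∂π, ‖F z‖ ≤ B)
    (hFV : ∀ u : EuclideanSpace ℝ (Fin d), ‖u‖ = 1 → ∫ z, inner ℝ u (F z) ^ 2 ∂π ≤ V)
    {n : ℕ} (hn : 0 < n) {t : ℝ} (ht : 0 < t) :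
    1 - 2 * Real.exp (-t) ≤ μ.real {ω |
      ‖(1 / (n : ℝ)) • ∑ i ∈ Finset.range n, F (Z i ω) - ∫ z, F z ∂π‖ ≤
        2 * (2 * √(9 * V * (2 * (d + t)) / ((1 - specLambda P π) * n)) +
          4 * (2 * B) * (2 * (d + t)) / ((1 - specLambda P π) * n))} := by
  have hlp : 0 < 1 - specLambda P π := by linarith
  have hnp : (0 : ℝ) < n := by exact_mod_cast hn
  have hdt : 0 < 2 * ((d : ℝ) + t) := by positivity
  set r := 2 * √(9 * V * (2 * (d + t)) / ((1 - specLambda P π) * n)) +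
    4 * (2 * B) * (2 * (d + t)) / ((1 - specLambda P π) * n) with hr
  have hr0 : 0 ≤ r := by positivity
  have iF : Integrable F π := Integrable.of_bound hF.aestronglyMeasurable B hFB
  set m := ∫ z, F z ∂π with hm
  obtain ⟨N, hNcard, hN1, hN⟩ := exists_finset_half_norm_le_inner (EuclideanSpace ℝ (Fin d))
  rw [finrank_euclideanSpace_fin] at hNcard
  set bad : EuclideanSpace ℝ (Fin d) → Set Ω := fun u =>
    {ω | r ≤ (1 / (n : ℝ)) * ∑ i ∈ Finset.range n, inner ℝ u (F (Z i ω) - m)} with hbad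
  -- The deviation level `2 (d + t)` is chosen so that `5 ^ d ≤ exp (2 d)` absorbs the number of
  -- directions. Centring doubles the almost sure bound to `2 * B` and does not increase the second
  -- moment.
  have hprob : ∀ u ∈ N, μ.real (bad u) ≤ Real.exp (-(2 * (d + t))) := by
    intro u hu
    have hu1 := hN1 u hu
    have hmB : ‖m‖ ≤ B := by
      have := norm_integral_le_of_norm_le_const hFB
      simpa using this
    have iuF : Integrable (fun z => inner ℝ u (F z)) π := iF.const_inner u
    have ium : ∫ z, inner ℝ u (F z) ∂π = inner ℝ u m := integral_inner iF u
    have hb : ∀ᵐ z ∂π, |inner ℝ u (F z)| ≤ B := hFB.mono fun z hz =>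
      (abs_real_inner_le_norm u (F z)).trans (by rwa [hu1, one_mul])
    refine hZ.bernstein hl (f := fun z => inner ℝ u (F z - m)) (by fun_prop) (M := 2 * B)
      (by positivity) hV ?_ ?_ ?_ hn hdt
    · filter_upwards [hFB] with z hz
      refine (abs_real_inner_le_norm u _).trans ?_
      rw [hu1, one_mul]
      linarith [norm_sub_le (F z) m]
    · simp_rw [inner_sub_right]
      rw [integral_sub iuF (integrable_const _), ium]
      simp
    · refine le_trans ?_ (hFV u hu1)
      have i2 : Integrable (fun z => inner ℝ u (F z) ^ 2) π := by
        refine Integrable.of_bound (by fun_prop) (B ^ 2) (hb.mono fun z hz => ?_)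
        rw [norm_pow]
        exact pow_le_pow_left₀ (abs_nonneg _) hz 2
      have i3 : Integrable (fun z => 2 * inner ℝ u m * inner ℝ u (F z)) π := iuF.const_mul _
      have e : ∀ z, inner ℝ u (F z - m) ^ 2 =
          inner ℝ u (F z) ^ 2 - 2 * inner ℝ u m * inner ℝ u (F z) + inner ℝ u m ^ 2 :=
        fun z => by rw [inner_sub_right]; ring
      simp_rw [e]
      rw [integral_add (f := fun z => inner ℝ u (F z) ^ 2 - 2 * inner ℝ u m * inner ℝ u (F z))
        (i2.sub i3) (integrable_const _), integral_sub i2 i3, integral_const_mul, ium]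
      simp only [integral_const, probReal_univ, one_smul]
      nlinarith [sq_nonneg (inner ℝ u m)]
  have hunion : μ.real (⋃ u ∈ N, bad u) ≤ 2 * Real.exp (-t) := by
    have h5 : (5 : ℝ) ≤ Real.exp 2 := by
      have := Real.exp_one_gt_d9
      rw [show (2 : ℝ) = 1 + 1 by norm_num, Real.exp_add]
      nlinarith
    calc μ.real (⋃ u ∈ N, bad u) ≤ ∑ u ∈ N, μ.real (bad u) := measureReal_biUnion_finset_le _ _
      _ ≤ N.card • Real.exp (-(2 * (d + t))) := Finset.sum_le_card_nsmul _ _ _ hprob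
      _ ≤ 5 ^ d * Real.exp (-(2 * (d + t))) := by
          rw [nsmul_eq_mul]
          gcongr
          exact_mod_cast hNcard
      _ ≤ Real.exp 2 ^ d * Real.exp (-(2 * (d + t))) := by gcongr
      _ = Real.exp (-(2 * t)) := by
          rw [← Real.exp_nat_mul, ← Real.exp_add]
          ring_nf
      _ ≤ Real.exp (-t) := Real.exp_le_exp.2 (by linarith)
      _ ≤ 2 * Real.exp (-t) := by linarith [Real.exp_pos (-t)]
  set good : Set Ω := {ω |
    ‖(1 / (n : ℝ)) • ∑ i ∈ Finset.range n, F (Z i ω) - m‖ ≤ 2 * r} with hgood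
  have hcover : good ∪ (⋃ u ∈ N, bad u) = Set.univ := by
    refine Set.eq_univ_of_forall fun ω => ?_
    by_contra hω
    rw [Set.mem_union, not_or] at hω
    obtain ⟨h1, h2⟩ := hω
    have h1 : 2 * r < ‖(1 / (n : ℝ)) • ∑ i ∈ Finset.range n, F (Z i ω) - m‖ := not_le.1 h1
    obtain ⟨u, hu, huv⟩ := hN _ (norm_pos_iff.1 (lt_of_le_of_lt (by positivity) h1))
    refine h2 (Set.mem_biUnion hu ?_)
    change r ≤ _
    have e : (1 / (n : ℝ)) * ∑ i ∈ Finset.range n, inner ℝ u (F (Z i ω) - m) =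
        inner ℝ u ((1 / (n : ℝ)) • ∑ i ∈ Finset.range n, F (Z i ω) - m) := by
      simp_rw [inner_sub_right, inner_smul_right, inner_sum, Finset.sum_sub_distrib]
      simp
      field_simp
    rw [e]
    linarith
  have := measureReal_union_le (μ := μ) good (⋃ u ∈ N, bad u)
  rw [hcover, probReal_univ] at this
  linarith

lemma IsStationaryMarkovChain.norm_whiten_score_bound (hZ : IsStationaryMarkovChain P π μ Z)
    (hl : specLambda P π < 1) {d : ℕ} {x : S → EuclideanSpace ℝ (Fin d)} {ε : S → ℝ}
    {δ v τ κ t : ℝ} (hx : Measurable x) (hε : Measurable ε) (hA : (secondMoment π x).PosDef)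
    (hK : ∀ᵐ z ∂π, ‖whiten (secondMoment π x) (x z)‖ ≤ κ) (hκ : 0 < κ) (hδ : 0 < δ) (hδ1 : δ ≤ 1)
    (hv0 : 0 < v) (hint : Integrable (fun z => |ε z| ^ (1 + δ)) π)
    (h0 : π[ε | MeasurableSpace.comap x inferInstance] =ᵐ[π] fun _ => (0 : ℝ))
    (hv : ∀ᵐ z ∂π,
      (π[fun z => |ε z| ^ (1 + δ) | MeasurableSpace.comap x inferInstance]) z ≤ v)
    {n : ℕ} (hn : 0 < n) (hτ : 0 < τ) (ht : 0 < t) :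
    1 - 2 * Real.exp (-t) ≤ μ.real {ω |
      ‖whiten (secondMoment π x) ((1 / (n : ℝ)) • ∑ i ∈ Finset.range n,
        huberScore τ (ε (Z i ω)) • x (Z i ω))‖ ≤
        2 * (2 * √(9 * (v * τ ^ (1 - δ)) * (2 * (d + t)) / ((1 - specLambda P π) * n)) +
          4 * (2 * τ * κ) * (2 * (d + t)) / ((1 - specLambda P π) * n)) + v * τ ^ (-δ)} := by
  set A := secondMoment π x with hAdef
  set F : S → EuclideanSpace ℝ (Fin d) := fun z => huberScore τ (ε z) • whiten A (x z) with hFdef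
  have hm : MeasurableSpace.comap x inferInstance ≤ (inferInstance : MeasurableSpace S) :=
    hx.comap_le
  have hF : Measurable F := by fun_prop
  have hFB : ∀ᵐ z ∂π, ‖F z‖ ≤ τ * κ := by
    filter_upwards [hK] with z hz
    rw [norm_smul, Real.norm_eq_abs, abs_huberScore hτ]
    exact mul_le_mul (min_le_right _ _) hz (norm_nonneg _) hτ.le
  have hq : ∀ u : EuclideanSpace ℝ (Fin d),
      StronglyMeasurable[MeasurableSpace.comap x inferInstance]
        (fun z => inner ℝ u (whiten A (x z))) := fun u => by
    have : Measurable fun w : EuclideanSpace ℝ (Fin d) => inner ℝ u (whiten A w) := by fun_prop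
    exact (this.comp (comap_measurable x)).stronglyMeasurable
  have hqK : ∀ u : EuclideanSpace ℝ (Fin d), ‖u‖ = 1 →
      ∀ᵐ z ∂π, |inner ℝ u (whiten A (x z))| ≤ κ := fun u hu => hK.mono fun z hz =>
    (abs_real_inner_le_norm _ _).trans (by rwa [hu, one_mul])
  have hq2 : ∀ u : EuclideanSpace ℝ (Fin d), ‖u‖ = 1 →
      ∫ z, inner ℝ u (whiten A (x z)) ^ 2 ∂π = 1 := fun u hu => by
    rw [integral_inner_whiten_sq hx hA hK, hu, one_pow]
  have iF : Integrable F π := Integrable.of_bound hF.aestronglyMeasurable _ hFB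
  have hmean : ‖∫ z, F z ∂π‖ ≤ v * τ ^ (-δ) := by
    set m := ∫ z, F z ∂π with hmdef
    rcases eq_or_ne m 0 with hm0 | hm0
    · rw [hm0, norm_zero]
      positivity
    -- Testing the mean in its own direction turns its norm into a scalar bias.
    · have hu : ‖(‖m‖⁻¹ • m)‖ = 1 := norm_smul_inv_norm (𝕜 := ℝ) hm0
      have h1 := abs_integral_huberScore_mul_le hm hε (hq _) (hqK _ hu) (hq2 _ hu) hτ hδ hv0 h0
        hint hv
      refine le_trans (le_of_eq ?_) ((le_abs_self _).trans h1)
      have e : ∀ z, huberScore τ (ε z) * inner ℝ (‖m‖⁻¹ • m) (whiten A (x z)) =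
          inner ℝ (‖m‖⁻¹ • m) (F z) := fun z => by rw [hFdef, inner_smul_right]
      simp_rw [e]
      rw [integral_inner iF, ← hmdef, real_inner_smul_left, real_inner_self_eq_norm_sq]
      have := norm_ne_zero_iff.2 hm0
      field_simp
  refine (hZ.norm_average_sub_integral_bound hl hF (B := τ * κ) (V := v * τ ^ (1 - δ))
    (by positivity) (by positivity) hFB (fun u hu => ?_) hn ht).trans
    (measureReal_mono fun ω hω => ?_)
  · simp_rw [hFdef, inner_smul_right]
    exact integral_huberScore_mul_sq_le hm (hq u) (hqK u hu) (hq2 u hu) hτ hδ hδ1 hint hv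
  · change (_ : ℝ) ≤ _ at hω
    change (_ : ℝ) ≤ _
    have e : whiten A ((1 / (n : ℝ)) • ∑ i ∈ Finset.range n, huberScore τ (ε (Z i ω)) • x (Z i ω)) =
        ((1 / (n : ℝ)) • ∑ i ∈ Finset.range n, F (Z i ω) - ∫ z, F z ∂π) + ∫ z, F z ∂π := by
      rw [sub_add_cancel, whiten, map_smul, map_sum]
      simp_rw [map_smul]
      rfl
    rw [e, mul_assoc 2 τ κ]
    exact (norm_add_le _ _).trans (add_le_add hω hmean)

end Score

end HuberMarkov

open HuberMarkov in
theorem proposition1 (K : ℝ) :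
    ∃ C₀ : ℝ, 0 < C₀ ∧
      ∀ {S Ω : Type*} [MeasurableSpace S] [MeasurableSpace Ω]
        (P : Kernel S S) [IsMarkovKernel P] (π : Measure S) [IsProbabilityMeasure π]
        (μ : Measure Ω) [IsProbabilityMeasure μ] (Z : ℕ → Ω → S)
        (d : ℕ) (x : S → EuclideanSpace ℝ (Fin d)) (y : S → ℝ)
        (βstar : EuclideanSpace ℝ (Fin d)) (ε : S → ℝ) (δ vδ : ℝ),
        IsStationaryMarkovChain P π μ Z →
        specLambda P π < 1 →
        Measurable x → Measurable y →
        (∀ z, y z = inner ℝ (x z) βstar + ε z) →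
        (secondMoment π x).PosDef →
        (∀ᵐ z ∂π, ‖whiten (secondMoment π x) (x z)‖ ≤ K) →
        0 < δ → δ ≤ 1 → 0 < vδ →
        Integrable (fun z => |ε z| ^ (1 + δ)) π →
        π[ε | MeasurableSpace.comap x inferInstance] =ᵐ[π] (fun _ => (0 : ℝ)) →
        (∀ᵐ z ∂π,
          (π[fun z => |ε z| ^ (1 + δ) | MeasurableSpace.comap x inferInstance]) z ≤ vδ) →
        (∀ u : EuclideanSpace ℝ (Fin d), ‖u‖ = 1 → ∀ p : ℝ, 0 ≤ p →
          π.real {z | p ≤ |inner ℝ u (whiten (secondMoment π x) (x z))|} ≤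
            2 * Real.exp (-(p ^ 2 / C₀ ^ 2))) ∧
        ∀ (n : ℕ) (τ t : ℝ), 0 < n → 0 < τ → 0 < t →
          1 - 2 * Real.exp (-t) ≤
            μ.real {ω |
              ‖whiten (secondMoment π x)
                (gradient
                  (empiricalLoss τ n (fun i => x (Z i ω)) (fun i => y (Z i ω))) βstar)‖ ≤
              4 * Real.sqrt Real.pi * C₀ * A2 (specLambda P π) * ((d : ℝ) + t) * τ / (n : ℝ)
                + 4 * C₀ * Real.sqrt
                    (A1 (specLambda P π) * vδ * τ ^ (1 - δ) * ((d : ℝ) + t) / (n : ℝ))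
                + vδ * τ ^ (-δ)} := by
  -- The maximum keeps the constant positive for every real `K` and supplies the bound `1 ≤ κ` used
  -- in the numerical comparison.
  set κ := max K 1 with hκ
  have hκ1 : 1 ≤ κ := le_max_right _ _
  refine ⟨24 * κ, by positivity, ?_⟩
  intro S Ω _ _ P _ π _ μ _ Z d x y βstar ε δ vδ hZ hl hx hy hyε hA hK hδ hδ1 hv0 hint hε0 hv
  have hKκ : ∀ᵐ z ∂π, ‖whiten (secondMoment π x) (x z)‖ ≤ κ :=
    hK.mono fun z hz => hz.trans (le_max_left _ _)
  refine ⟨fun u hu p hp => measureReal_le_abs_inner_whiten hκ1 hKκ hu hp, ?_⟩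
  intro n τ t hn hτ ht
  have hε : Measurable ε := by
    have : ε = fun z => y z - inner ℝ (x z) βstar := funext fun z => by rw [hyε]; ring
    rw [this]
    fun_prop
  have hdt : 0 < (d : ℝ) + t := by positivity
  have hV : 0 < vδ * τ ^ (1 - δ) := by positivity
  refine (hZ.norm_whiten_score_bound hl hx hε hA hKκ (by positivity) hδ hδ1 hv0 hint hε0 hv hn hτ
    ht).trans (measureReal_mono fun ω hω => ?_)
  have hG : ‖whiten (secondMoment π x) (gradient
      (empiricalLoss τ n (fun i => x (Z i ω)) (fun i => y (Z i ω))) βstar)‖ =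
      ‖whiten (secondMoment π x) ((1 / (n : ℝ)) • ∑ i ∈ Finset.range n,
        huberScore τ (ε (Z i ω)) • x (Z i ω))‖ := by
    rw [(hasGradientAt_empiricalLoss hτ n _ _ βstar).gradient, whiten, map_neg, norm_neg, whiten]
    simp only [hyε, add_sub_cancel_left]
  change (_ : ℝ) ≤ _
  rw [hG]
  change (_ : ℝ) ≤ _ at hω
  refine hω.trans ?_
  gcongr ?_ + _
  have hnp : (0 : ℝ) < n := by exact_mod_cast hn
  have hc := bernstein_constants_le hκ1 (specLambda_nonneg P π) hl hV.le hdt.le hτ.le hnp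
  rw [← mul_assoc (A1 (specLambda P π))] at hc
  exact hc
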